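/- Let $G$ be a unimodular, amenable, locally compact, second-countable Hausdorff group with identity $e$ and a fixed Haar measure $m$. Let $\mathcal C(G)$ be the set of closed subsets of $G$ with the Chabauty--Fell topology, which is generated by the sets $\{C : C\cap K=\emptyset\}$ ($K\subseteq G$ compact) and $\{C : C\cap V\neq\emptyset\}$ ($V\subseteq G$ open), and let $G$ act on it by left translation. For $\Lambda\subseteq G$ put $\operatorname{rel}(\Lambda)=\inf_U\sup_{x\in G}|\Lambda\cap xU|$, the infimum being over all neighbourhoods $U$ of $e$. The set $\Lambda$ is called *relatively separated* if $\operatorname{rel}(\Lambda)<\infty$; *separated* if there is a neighbourhood $U$ of $e$ with $|\Lambda\cap xU|\le 1$ for all $x\in G$; *relatively dense* if there is a compact $K\subseteq G$ with $\Lambda\cap xK\ne\emptyset$ for all $x\in G$; and *Delone* if it is separated and relatively dense. The lower and upper Beurling densities of $\Lambda$ are $$D^-(\Lambda)=\sup_K\inf_{x\in G}\frac{|\Lambda\cap xK|}{m(K)},\qquad D^+(\Lambda)=\inf_K\sup_{x\in G}\frac{|\Lambda\cap xK|}{m(K)},$$ where $K$ runs over the compact subsets of $G$ with $m(K)>0$.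 A relatively separated set $\Lambda$ is closed. Its punctured hull $\Omega^\times(\Lambda)$ is the closure of $\{x\Lambda : x\in G\}$ in $\mathcal C(G)$ with the point $\emptyset$ removed. Let $\mathcal M(\Lambda)$ be the set of all finite $G$-invariant Borel measures $\mu$ on $\Omega^\times(\Lambda)$ that are normalized by the generalized Weil formula $$\int_{\Omega^\times(\Lambda)}\sum_{x\in P}f(x)\,d\mu(P)=\int_G f\,dm\qquad\text{for all } f\in C_c(G).$$ The lower and upper covolumes of $\Lambda$ are $$\operatorname{covol}_-(\Lambda)=\inf_{\mu\in\mathcal M(\Lambda)}\mu(\Omega^\times(\Lambda)),\qquad \operatorname{covol}_+(\Lambda)=\sup_{\mu\in\mathcal M(\Lambda)}\mu(\Omega^\times(\Lambda)),$$ with $\operatorname{covol}_-(\Lambda)=\infty$ and $\operatorname{covol}_+(\Lambda)=0$ if $\mathcal M(\Lambda)=\emptyset$. **Theorem.** Let $\Lambda\subseteq G$, with the conventions $1/\infty=0$, $1/0=\infty$ and $\infty\cdot 0=0$ in $[0,\infty]$. 1. If $\Lambda$ is a Delone set, then $D^-(\Lambda)=\dfrac1{\operatorname{covol}_+(\Lambda)}$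 and $D^+(\Lambda)=\dfrac1{\operatorname{covol}_-(\Lambda)}$. 2. If $\Lambda$ is relatively separated, then $\operatorname{rel}(\Lambda)^{-1}\cdot D^+(\Lambda)\le\dfrac1{\operatorname{covol}_-(\Lambda)}\le D^+(\Lambda)$. 3. If $\Lambda$ is relatively separated and relatively dense, then $\operatorname{rel}(\Lambda)^{-1}\cdot D^-(\Lambda)\le\dfrac1{\operatorname{covol}_+(\Lambda)}\le D^-(\Lambda)$. -/

import Mathlib

open MeasureTheory Topology Set
open scoped ENNReal NNReal Pointwise BoundedContinuousFunction CompactlySupported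

noncomputable section

namespace PointSetCovolume

/-! ### Amenability -/

/-- A topological group is amenable if the space of bounded continuous real functions on it
carries a left-invariant mean: a positive, normalized linear functional `M` with `M (L_x f) = M f`,
where `(L_x f) y = f (x * y)`. -/
def IsAmenable (G : Type*) [Group G] [TopologicalSpace G] [IsTopologicalGroup G] : Prop :=
  ∃ M : (G →ᵇ ℝ) →ₗ[ℝ] ℝ,
    (∀ f : G →ᵇ ℝ, (∀ y, 0 ≤ f y) → 0 ≤ M f) ∧
    M (BoundedContinuousFunction.const G 1) = 1 ∧
    ∀ (x : G) (f : G →ᵇ ℝ),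
      M (f.compContinuous ⟨fun y => x * y, continuous_const_mul x⟩) = M f

/-! ### The Chabauty–Fell space of closed subsets -/

/-- The set of all closed subsets of `G`. -/
@[ext]
structure ClosedSubsets (G : Type*) [TopologicalSpace G] where
  /-- The underlying set. -/
  carrier : Set G
  isClosed_carrier : IsClosed carrier

/-- The Chabauty–Fell topology: it is generated by the sets of those `C` that miss a given
compact set and the sets of those `C` that meet a given open set. -/
instance {G : Type*} [TopologicalSpace G] : TopologicalSpace (ClosedSubsets G) :=
  TopologicalSpace.generateFrom
    ({S | ∃ K : Set G, IsCompact K ∧ S = {C : ClosedSubsets G | C.carrier ∩ K = ∅}} ∪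
      {S | ∃ V : Set G, IsOpen V ∧ S = {C : ClosedSubsets G | (C.carrier ∩ V).Nonempty}})

/-- The space of closed subsets carries the Borel sigma-algebra of its topology. -/
instance {G : Type*} [TopologicalSpace G] : MeasurableSpace (ClosedSubsets G) :=
  borel (ClosedSubsets G)

instance {G : Type*} [TopologicalSpace G] : BorelSpace (ClosedSubsets G) := ⟨rfl⟩

section Action

variable {G : Type*} [Group G] [TopologicalSpace G] [IsTopologicalGroup G]

/-- The action of `G` on closed subsets by left translation, `x • C = {x * y | y ∈ C}`. -/
instance : MulAction G (ClosedSubsets G) where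
  smul x C := ⟨x • C.carrier, C.isClosed_carrier.smul x⟩
  one_smul C := ClosedSubsets.ext (one_smul G C.carrier)
  mul_smul x y C := ClosedSubsets.ext (mul_smul x y C.carrier)

end Action

/-! ### Point sets -/

section PointSets

variable {G : Type*} [Group G] [TopologicalSpace G]

/-- `rel(Λ) = inf_U sup_x |Λ ∩ xU|`, where `U` runs over the neighbourhoods of the identity. -/
def rel (Λ : Set G) : ℕ∞ :=
  ⨅ U ∈ 𝓝 (1 : G), ⨆ x : G, (Λ ∩ x • U).encard

/-- `Λ` is relatively separated if `rel(Λ)` is finite. -/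
def IsRelativelySeparated (Λ : Set G) : Prop :=
  rel Λ < ⊤

/-- `Λ` is separated if there is a neighbourhood `U` of the identity such that every left translate
of `U` contains at most one point of `Λ`. -/
def IsSeparated (Λ : Set G) : Prop :=
  ∃ U ∈ 𝓝 (1 : G), ∀ x : G, (Λ ∩ x • U).encard ≤ 1

/-- `Λ` is relatively dense if there is a compact set `K` such that every left translate of `K`
meets `Λ`. -/
def IsRelativelyDense (Λ : Set G) : Prop :=
  ∃ K : Set G, IsCompact K ∧ ∀ x : G, (Λ ∩ x • K).Nonempty

/-- A Delone set is a separated and relatively dense set. -/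
def IsDelone (Λ : Set G) : Prop :=
  IsSeparated Λ ∧ IsRelativelyDense Λ

/-- The hull of `Λ`: the closure, in the Chabauty–Fell topology, of the set of all left translates
of `Λ`. (It is meant for closed `Λ`; relatively separated sets are closed.) -/
def hull (Λ : Set G) : Set (ClosedSubsets G) :=
  closure {C | ∃ x : G, C.carrier = x • Λ}

/-- The punctured hull of `Λ`: the hull without the empty set. -/
def puncturedHull (Λ : Set G) : Set (ClosedSubsets G) :=
  hull Λ \ {C | C.carrier = ∅}

end PointSets

/-! ### Beurling densities and covolumes -/

section Density

variable {G : Type*} [Group G] [TopologicalSpace G] [MeasurableSpace G]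

/-- The lower Beurling density `sup_K inf_x |Λ ∩ xK| / m(K)`, where `K` runs over the compact sets
of positive measure. -/
def lowerBeurlingDensity (m : Measure G) (Λ : Set G) : ℝ≥0∞ :=
  ⨆ (K : Set G) (_ : IsCompact K ∧ 0 < m K), ⨅ x : G, ((Λ ∩ x • K).encard : ℝ≥0∞) / m K

/-- The upper Beurling density `inf_K sup_x |Λ ∩ xK| / m(K)`, where `K` runs over the compact sets
of positive measure. -/
def upperBeurlingDensity (m : Measure G) (Λ : Set G) : ℝ≥0∞ :=
  ⨅ (K : Set G) (_ : IsCompact K ∧ 0 < m K), ⨆ x : G, ((Λ ∩ x • K).encard : ℝ≥0∞) / m K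

variable [IsTopologicalGroup G]

/-- `μ` is a finite `G`-invariant Borel measure on the punctured hull of `Λ` (seen as a measure on
the space of closed subsets that is concentrated on the punctured hull), normalized such that the
generalized Weil formula
`∫ ∑_{x ∈ P} f(x) dμ(P) = ∫ f dm` holds for all `f ∈ C_c(G)`. The formula is required for
nonnegative `f`, where both sides make sense in `[0, ∞]`; for other `f` it follows by linearity. -/
structure IsNormalizedHullMeasure (m : Measure G) (Λ : Set G)
    (μ : Measure (ClosedSubsets G)) : Prop where
  finite : IsFiniteMeasure μ
  concentrated : μ (puncturedHull Λ)ᶜ = 0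
  invariant : SMulInvariantMeasure G (ClosedSubsets G) μ
  weil : ∀ f : C_c(G, ℝ≥0),
    ∫⁻ P, ∑' x : P.carrier, (f x : ℝ≥0∞) ∂μ = ∫⁻ x, (f x : ℝ≥0∞) ∂m

/-- The lower covolume: the infimum of the total masses of the normalized finite invariant measures
on the punctured hull (`∞` if there are none). -/
def lowerCovolume (m : Measure G) (Λ : Set G) : ℝ≥0∞ :=
  ⨅ (μ : Measure (ClosedSubsets G)) (_ : IsNormalizedHullMeasure m Λ μ), μ (puncturedHull Λ)

/-- The upper covolume: the supremum of the total masses of the normalized finite invariant measures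
on the punctured hull (`0` if there are none). -/
def upperCovolume (m : Measure G) (Λ : Set G) : ℝ≥0∞ :=
  ⨆ (μ : Measure (ClosedSubsets G)) (_ : IsNormalizedHullMeasure m Λ μ), μ (puncturedHull Λ)

end Density

end PointSetCovolume

end

open PointSetCovolume

namespace PointSetCovolume

set_option linter.unusedSectionVars false

/-! ### The Chabauty–Fell space -/

section FellSpace

variable {X : Type*} [TopologicalSpace X]

/-! Each half of the theorem pairs a bound valid for every normalized measure `μ` with the
construction of a nearly extremal one.

Bounds. The Weil formula is applied to a smoothed indicator `φ` of a compact `K`: its integral is `m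
K`, and its sum over a translate of `Λ` is an average of the counts `|Λ ∩ xK|` (`exists_smoothing`).
An upper bound for such sums survives limits in the hull, because the sum is lower semicontinuous
(`tsum_le_of_mem_hull`). A lower bound survives only up to the factor `rel Λ`, because up to `rel Λ`
points may merge in the limit (`le_rel_mul_tsum_of_mem_hull`). This gives `1 / μ(univ) ≤ D⁺` and `D⁻
* μ(univ) ≤ rel Λ`, without amenability.

Existence. Amenability gives Følner sets, through Hahn–Banach and superlevel sets of almost
invariant densities. They are translated to places where the count is nearly largest or smallest,
and the orbit of `Λ` is averaged over them. The space of closed sets is compact and metrizable, so a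
subsequence converges weakly to an invariant probability measure on the hull
(`exists_invariant_limit`). By uniqueness of Haar measure it satisfies the Weil formula up to a
constant `c` (`exists_intensity`); dividing by `c` and discarding the empty set normalizes it. For
`d < D⁺` merging costs a factor and gives `d ≤ rel Λ * c`, so the mass, at most `1 / c`, is at most
`rel Λ / d`. For `d > D⁻`, semicontinuity gives `c ≤ d` without loss, and relative density excludes
the empty set, so the mass is exactly `1 / c`. For Delone sets `rel Λ = 1` and the inequalities
become equalities. -/

lemma isOpen_setOf_miss {K : Set X} (hK : IsCompact K) :
    IsOpen {C : ClosedSubsets X | C.carrier ∩ K = ∅} :=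
  TopologicalSpace.isOpen_generateFrom_of_mem (Or.inl ⟨K, hK, rfl⟩)

lemma isOpen_setOf_hit {V : Set X} (hV : IsOpen V) :
    IsOpen {C : ClosedSubsets X | (C.carrier ∩ V).Nonempty} :=
  TopologicalSpace.isOpen_generateFrom_of_mem (Or.inr ⟨V, hV, rfl⟩)

lemma isClosed_setOf_carrier_eq_empty : IsClosed {C : ClosedSubsets X | C.carrier = ∅} := by
  rw [← isOpen_compl_iff]
  convert isOpen_setOf_hit (X := X) isOpen_univ using 1
  ext C
  simp [nonempty_iff_ne_empty]

/-- A point of one set outside the other has a compact neighbourhood `K` missing the other set;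
meeting `interior K` and missing `K` are disjoint open conditions. -/
instance [T2Space X] [LocallyCompactSpace X] : T2Space (ClosedSubsets X) := by
  have key : ∀ (C D : ClosedSubsets X) (x : X), x ∈ C.carrier → x ∉ D.carrier →
      ∃ U V : Set (ClosedSubsets X), IsOpen U ∧ IsOpen V ∧ C ∈ U ∧ D ∈ V ∧ Disjoint U V := by
    intro C D x hC hD
    obtain ⟨K, hK, hxK, hKD⟩ := exists_compact_subset D.isClosed_carrier.isOpen_compl hD
    refine ⟨_, _, isOpen_setOf_hit (isOpen_interior (s := K)), isOpen_setOf_miss hK,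
      ⟨x, hC, hxK⟩, ?_, ?_⟩
    · exact (disjoint_compl_right.mono_right hKD).inter_eq
    · rw [Set.disjoint_left]
      rintro E ⟨y, hy, hyK⟩ (hE : E.carrier ∩ K = ∅)
      exact (hE ▸ ⟨hy, interior_subset hyK⟩ : y ∈ (∅ : Set X))
  refine ⟨fun C D hCD => ?_⟩
  have : C.carrier ≠ D.carrier := fun h => hCD (ClosedSubsets.ext h)
  by_cases h : C.carrier ⊆ D.carrier
  · obtain ⟨x, hxD, hxC⟩ := not_subset.1 fun h' => this (h.antisymm h')
    obtain ⟨U, V, hU, hV, h1, h2, h3⟩ := key D C x hxD hxC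
    exact ⟨V, U, hV, hU, h2, h1, h3.symm⟩
  · obtain ⟨x, hxC, hxD⟩ := not_subset.1 h
    exact key C D x hxC hxD

/-- An ultrafilter of closed sets converges to the set of points all of whose neighbourhoods are met
by almost every member. Any other point has a neighbourhood missed by almost every member, and
finitely many of these cover a compact set. -/
instance : CompactSpace (ClosedSubsets X) := by
  refine ⟨isCompact_iff_ultrafilter_le_nhds.2 fun 𝓤 _ => ?_⟩
  let L : Set X := {x | ∀ V ∈ 𝓝 x, ∀ᶠ C : ClosedSubsets X in 𝓤, (C.carrier ∩ V).Nonempty}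
  have hL : IsClosed L := by
    refine isClosed_iff_nhds.2 fun x hx V hV => ?_
    obtain ⟨W, hWV, hW, hxW⟩ := mem_nhds_iff.1 hV
    obtain ⟨y, hyW, hyL⟩ := hx W (hW.mem_nhds hxW)
    exact (hyL W (hW.mem_nhds hyW)).mono fun C hC => hC.mono (inter_subset_inter_right _ hWV)
  refine ⟨⟨L, hL⟩, mem_univ _, ?_⟩
  rw [TopologicalSpace.nhds_generateFrom]
  refine le_iInf₂ fun s hs => Filter.le_principal_iff.2 ?_
  obtain ⟨hLs, ⟨K, hK, rfl⟩ | ⟨V, hV, rfl⟩⟩ := hs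
  · change ∀ᶠ C : ClosedSubsets X in 𝓤, C.carrier ∩ K = ∅
    refine hK.induction_on (p := fun S => ∀ᶠ C : ClosedSubsets X in 𝓤, C.carrier ∩ S = ∅)
      (by simp) ?_ ?_ ?_
    · exact fun S T hST h => h.mono fun C hC =>
        subset_eq_empty (inter_subset_inter_right _ hST) hC
    · exact fun S T hS hT => (hS.and hT).mono fun C hC => by
        rw [inter_union_distrib_left, hC.1, hC.2, union_empty]
    · intro x hxK
      have hxL : x ∉ L := fun h => (hLs ▸ ⟨h, hxK⟩ : x ∈ (∅ : Set X))
      simp only [L, mem_ofPred_eq, not_forall] at hxL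
      obtain ⟨V, hV, h⟩ := hxL
      refine ⟨V, mem_nhdsWithin_of_mem_nhds hV, ?_⟩
      rw [← Ultrafilter.eventually_not] at h
      exact h.mono fun C hC => not_nonempty_iff_eq_empty.1 hC
  · obtain ⟨x, hxL, hxV⟩ := hLs
    exact hxL V (hV.mem_nhds hxV)

/-- With a countable basis of `X`, it suffices to use the conditions of meeting a basic set `b` and
of missing `closure b` when that is compact. -/
instance [T2Space X] [LocallyCompactSpace X] [SecondCountableTopology X] :
    SecondCountableTopology (ClosedSubsets X) := by
  set B := TopologicalSpace.countableBasis X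
  have hB : TopologicalSpace.IsTopologicalBasis B := TopologicalSpace.isBasis_countableBasis X
  have hBc : B.Countable := TopologicalSpace.countable_countableBasis X
  let S : Set (Set (ClosedSubsets X)) :=
    (fun b => {C : ClosedSubsets X | (C.carrier ∩ b).Nonempty}) '' B ∪
      (fun b => {C : ClosedSubsets X | C.carrier ∩ closure b = ∅}) ''
        {b ∈ B | IsCompact (closure b)}
  refine ⟨⟨S, (hBc.image _).union ((hBc.mono (sep_subset _ _)).image _), ?_⟩⟩
  refine le_antisymm (le_generateFrom ?_) (le_generateFrom ?_)
  · rintro s (⟨b, hb, rfl⟩ | ⟨b, hb, rfl⟩)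
    · exact isOpen_setOf_hit (hB.isOpen hb)
    · exact isOpen_setOf_miss hb.2
  · rintro s (⟨K, hK, rfl⟩ | ⟨V, hV, rfl⟩)
    · let _ : TopologicalSpace (ClosedSubsets X) := TopologicalSpace.generateFrom S
      refine isOpen_iff_mem_nhds.2 fun C hC => ?_
      have : ∃ U : Set (ClosedSubsets X), IsOpen U ∧ C ∈ U ∧ ∀ D ∈ U, D.carrier ∩ K = ∅ := by
        refine hK.induction_on (p := fun T => ∃ U : Set (ClosedSubsets X), IsOpen U ∧ C ∈ U ∧
          ∀ D ∈ U, D.carrier ∩ T = ∅) ⟨univ, isOpen_univ, mem_univ _, by simp⟩ ?_ ?_ ?_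
        · rintro T T' hTT ⟨U, h1, h2, h3⟩
          exact ⟨U, h1, h2, fun D hD => subset_eq_empty (inter_subset_inter_right _ hTT) (h3 D hD)⟩
        · rintro T T' ⟨U, h1, h2, h3⟩ ⟨U', h1', h2', h3'⟩
          refine ⟨U ∩ U', h1.inter h1', ⟨h2, h2'⟩, fun D hD => ?_⟩
          rw [inter_union_distrib_left, h3 D hD.1, h3' D hD.2, union_empty]
        · intro x hx
          have hxC : x ∈ C.carrierᶜ := fun h => (hC ▸ ⟨h, hx⟩ : x ∈ (∅ : Set X))
          obtain ⟨K', hK', hxK', hKC⟩ :=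
            exists_compact_subset C.isClosed_carrier.isOpen_compl hxC
          obtain ⟨b, hb, hxb, hbK⟩ := hB.exists_subset_of_mem_open hxK' isOpen_interior
          have hcl : closure b ⊆ K' := closure_minimal (hbK.trans interior_subset) hK'.isClosed
          refine ⟨b, mem_nhdsWithin_of_mem_nhds ((hB.isOpen hb).mem_nhds hxb), _,
            TopologicalSpace.isOpen_generateFrom_of_mem (Or.inr ⟨b, ⟨hb,
              hK'.of_isClosed_subset isClosed_closure hcl⟩, rfl⟩), ?_, fun D hD => ?_⟩
          · exact (disjoint_compl_right.mono_right (hcl.trans hKC)).inter_eq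
          · exact subset_eq_empty (inter_subset_inter_right _ subset_closure) hD
      obtain ⟨U, h1, h2, h3⟩ := this
      exact Filter.mem_of_superset (h1.mem_nhds h2) h3
    · have : {C : ClosedSubsets X | (C.carrier ∩ V).Nonempty} =
          ⋃ b ∈ {b ∈ B | b ⊆ V}, {C : ClosedSubsets X | (C.carrier ∩ b).Nonempty} := by
        ext C
        simp only [mem_ofPred_eq, mem_iUnion, exists_prop]
        constructor
        · rintro ⟨x, hxC, hxV⟩
          obtain ⟨b, hb, hxb, hbV⟩ := hB.exists_subset_of_mem_open hxV hV
          exact ⟨b, ⟨hb, hbV⟩, x, hxC, hxb⟩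
        · rintro ⟨b, ⟨-, hbV⟩, h⟩
          exact h.mono (inter_subset_inter_right _ hbV)
      rw [this]
      let _ : TopologicalSpace (ClosedSubsets X) := TopologicalSpace.generateFrom S
      exact isOpen_biUnion fun b hb =>
        TopologicalSpace.isOpen_generateFrom_of_mem (Or.inl ⟨b, hb.1, rfl⟩)

instance [T2Space X] [LocallyCompactSpace X] [SecondCountableTopology X] :
    TopologicalSpace.MetrizableSpace (ClosedSubsets X) :=
  TopologicalSpace.metrizableSpace_of_t3_secondCountable _

/-- The sum of `φ` over the points of a closed set is lower semicontinuous. -/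
lemma lowerSemicontinuous_tsum [T2Space X] {φ : X → ℝ≥0∞} (hφ : Continuous φ) :
    LowerSemicontinuous fun P : ClosedSubsets X => ∑' x : P.carrier, φ x := by
  intro P c hc
  change c < ∑' x : P.carrier, φ x at hc
  rw [ENNReal.tsum_eq_iSup_sum] at hc
  obtain ⟨s, hs⟩ := lt_iSup_iff.1 hc
  have hopen : IsOpen {y : s → X | c < ∑ i, φ (y i)} :=
    isOpen_lt continuous_const
      (continuous_finsetSum _ fun i _ => hφ.comp (continuous_apply i))
  have hmem : (fun i : s => ((i : P.carrier) : X)) ∈ {y : s → X | c < ∑ i, φ (y i)} := by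
    change c < ∑ i : s, φ ((i : P.carrier) : X)
    rwa [Finset.sum_coe_sort s fun i : P.carrier => φ i]
  obtain ⟨u, hu, hsub⟩ := isOpen_pi_iff'.1 hopen _ hmem
  -- Disjoint neighbourhoods force the points found in a nearby closed set to be distinct, so each
  -- contributes its own term.
  obtain ⟨U, hU, hdisj⟩ := ((s.finite_toSet).image ((↑) : P.carrier → X)).t2_separation
  have hev : ∀ᶠ D : ClosedSubsets X in 𝓝 P,
      ∀ i : s, (D.carrier ∩ (u i ∩ U ((i : P.carrier) : X))).Nonempty := by
    refine Filter.eventually_all.2 fun i => ?_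
    exact (isOpen_setOf_hit ((hu i).1.inter (hU _).2)).mem_nhds
      ⟨_, i.1.2, (hu i).2, (hU _).1⟩
  filter_upwards [hev] with D hD
  choose y hyD hyu hyU using hD
  have hinj : Function.Injective fun i : s => (⟨y i, hyD i⟩ : D.carrier) := by
    intro i j hij
    have hij' : y i = y j := congrArg Subtype.val hij
    by_contra hne
    have hne' : ((i : P.carrier) : X) ≠ ((j : P.carrier) : X) := fun h =>
      hne (Subtype.ext (Subtype.ext h))
    exact (Set.disjoint_left.1 (hdisj (mem_image_of_mem _ i.2) (mem_image_of_mem _ j.2) hne'))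
      (hyU i) (hij' ▸ hyU j)
  calc c < ∑ i, φ (y i) := hsub (show y ∈ univ.pi u from fun i _ => hyu i)
    _ = ∑ x ∈ Finset.univ.map ⟨fun i : s => (⟨y i, hyD i⟩ : D.carrier), hinj⟩, φ x := by
        rw [Finset.sum_map]; rfl
    _ ≤ ∑' x : D.carrier, φ x := ENNReal.sum_le_tsum _

/-- The supremum over the points of a closed set of a continuous function with compact support is
continuous. -/
lemma continuous_biSup {φ : X → ℝ≥0∞} (hφ : Continuous φ)
    (hc : HasCompactSupport φ) :
    Continuous fun P : ClosedSubsets X => ⨆ x ∈ P.carrier, φ x := by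
  refine continuous_iff_lower_upperSemicontinuous.2 ⟨fun P c h => ?_, fun P c h => ?_⟩
  · simp only [lt_iSup_iff] at h
    obtain ⟨x, hx, hcx⟩ := h
    filter_upwards [(isOpen_setOf_hit (isOpen_lt continuous_const hφ)).mem_nhds
      (show (P.carrier ∩ {y | c < φ y}).Nonempty from ⟨x, hx, hcx⟩)] with D hD
    obtain ⟨y, hyD, hy⟩ := hD
    exact lt_of_lt_of_le hy (le_iSup₂ (f := fun z (_ : z ∈ D.carrier) => φ z) y hyD)
  -- An intermediate `c'` is positive, or at least above the supremum, so `{c' ≤ φ}` is a compact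
  -- set missed by `P`; missing it is an open condition.
  · obtain ⟨c', hc', hcc⟩ := exists_between h
    have hK : IsCompact {y | c' ≤ φ y} := by
      refine hc.isCompact.of_isClosed_subset (isClosed_le continuous_const hφ) fun y hy => ?_
      exact subset_tsupport _ (ne_of_gt (lt_of_lt_of_le (bot_le.trans_lt hc') hy))
    have hP : P.carrier ∩ {y | c' ≤ φ y} = ∅ := by
      refine eq_empty_of_forall_notMem fun y hy => ?_
      exact absurd (hy.2.trans (le_iSup₂ (f := fun z (_ : z ∈ P.carrier) => φ z) y hy.1))
        (not_le.2 hc')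
    filter_upwards [(isOpen_setOf_miss hK).mem_nhds hP] with D hD
    refine lt_of_le_of_lt (iSup₂_le fun y hy => ?_) hcc
    by_contra hlt
    exact (hD ▸ ⟨hy, (not_le.1 hlt).le⟩ : y ∈ (∅ : Set X))

end FellSpace

/-! ### The translation action on the Chabauty–Fell space. -/

section FellAction

variable {G : Type*} [Group G] [TopologicalSpace G] [IsTopologicalGroup G]

@[simp]
lemma carrier_smul (x : G) (C : ClosedSubsets G) : (x • C).carrier = x • C.carrier := rfl

instance : ContinuousConstSMul G (ClosedSubsets G) := by
  refine ⟨fun x => continuous_generateFrom_iff.2 ?_⟩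
  rintro s (⟨K, hK, rfl⟩ | ⟨V, hV, rfl⟩)
  · convert isOpen_setOf_miss (hK.smul x⁻¹) using 1
    ext C
    change x • C.carrier ∩ K = ∅ ↔ C.carrier ∩ x⁻¹ • K = ∅
    rw [← smul_set_eq_empty (a := x⁻¹), smul_set_inter, inv_smul_smul]
  · convert isOpen_setOf_hit (hV.smul x⁻¹) using 1
    ext C
    change (x • C.carrier ∩ V).Nonempty ↔ (C.carrier ∩ x⁻¹ • V).Nonempty
    rw [← smul_set_nonempty (a := x⁻¹), smul_set_inter, inv_smul_smul]

/-- The translates meeting a compact `K` are parametrized by `K * C⁻¹`, a closed set; those meeting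
an open `V` by a union of right translates of `V`. -/
lemma continuous_smul_closedSubsets [T2Space G] (C : ClosedSubsets G) :
    Continuous fun x : G => x • C := by
  refine continuous_generateFrom_iff.2 ?_
  rintro s (⟨K, hK, rfl⟩ | ⟨V, hV, rfl⟩)
  · rw [← isClosed_compl_iff]
    convert C.isClosed_carrier.inv.mul_left_of_isCompact hK using 1
    ext x
    change ¬ (x • C.carrier ∩ K = ∅) ↔ x ∈ K * C.carrier⁻¹
    rw [← ne_eq, ← nonempty_iff_ne_empty, mem_mul]
    constructor
    · rintro ⟨_, ⟨c, hc, rfl⟩, hk⟩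
      exact ⟨_, hk, c⁻¹, by simpa using hc, by simp⟩
    · rintro ⟨k, hk, c, hc, rfl⟩
      exact ⟨k, ⟨c⁻¹, hc, by simp⟩, hk⟩
  · have : (fun x : G => x • C) ⁻¹' {D | (D.carrier ∩ V).Nonempty} =
        ⋃ c ∈ C.carrier, (fun x => x * c) ⁻¹' V := by
      ext x
      simp only [mem_iUnion, exists_prop, mem_preimage]
      constructor
      · rintro ⟨_, ⟨c, hc, rfl⟩, hv⟩
        exact ⟨c, hc, hv⟩
      · rintro ⟨c, hc, hv⟩
        exact ⟨_, ⟨c, hc, rfl⟩, hv⟩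
    rw [this]
    exact isOpen_biUnion fun c _ => hV.preimage (continuous_mul_const c)

end FellAction

/-! ### Invariant means and Haar measure -/

section Mean

variable {G : Type*} [Group G] [TopologicalSpace G] [IsTopologicalGroup G]
  [LocallyCompactSpace G] [SecondCountableTopology G] [MeasurableSpace G] [BorelSpace G]

/-- A bi-invariant Haar measure is invariant under inversion. -/
instance (m : Measure G) [m.IsHaarMeasure] [m.IsMulRightInvariant] : m.IsInvInvariant := by
  constructor
  -- Inverting twice multiplies `m` by `c ^ 2`, whence `c = 1`.
  let c : ℝ≥0∞ := Measure.haarScalarFactor m.inv m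
  have hc : m.inv = c • m := Measure.isMulLeftInvariant_eq_smul m.inv m
  have : Measure.map Inv.inv (Measure.map Inv.inv m) = c ^ 2 • m := by
    rw [← Measure.inv_def m, hc, Measure.map_smul, ← Measure.inv_def m, hc, smul_smul, pow_two]
  have μeq : m = c ^ 2 • m := by
    rw [Measure.map_map continuous_inv.measurable continuous_inv.measurable] at this
    simpa only [inv_involutive, Function.Involutive.comp_self, Measure.map_id]
  have K : TopologicalSpace.PositiveCompacts G := Classical.arbitrary _
  have : c ^ 2 * m K = 1 ^ 2 * m K := by
    conv_rhs => rw [μeq]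
    simp
  have : c ^ 2 = 1 ^ 2 :=
    (ENNReal.mul_left_inj (Measure.measure_pos_of_nonempty_interior _ K.interior_nonempty).ne'
          K.isCompact.measure_lt_top.ne).1 this
  have : c = 1 := (ENNReal.pow_right_strictMono two_ne_zero).injective this
  rw [hc, this, one_smul]

variable (m : Measure G)

/-- The average `x ↦ ∫ k(y) F(y x) dm(y)` of left translates of a bounded continuous function. -/
noncomputable def translateAverage (F : G →ᵇ ℝ) (k : G → ℝ) (hk : Integrable k m) : G →ᵇ ℝ :=
  BoundedContinuousFunction.ofNormedAddCommGroup (fun x => ∫ y, k y * F (y * x) ∂m)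
    (by
      refine continuous_of_dominated (bound := fun y => ‖k y‖ * ‖F‖) (fun x => ?_) (fun x => ?_)
        (hk.norm.mul_const _) (ae_of_all _ fun y => by fun_prop)
      · exact hk.aestronglyMeasurable.mul
          (F.continuous.comp (continuous_mul_const x)).aestronglyMeasurable
      · exact ae_of_all _ fun y => by
          rw [norm_mul]; gcongr; exact F.norm_coe_le_norm _)
    ((∫ y, ‖k y‖ ∂m) * ‖F‖)
    (fun x => by
      rw [← integral_mul_const]
      refine norm_integral_le_of_norm_le (hk.norm.mul_const _) (ae_of_all _ fun y => ?_)
      rw [norm_mul]; gcongr; exact F.norm_coe_le_norm _)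

lemma translateAverage_apply (F : G →ᵇ ℝ) (k : G → ℝ) (hk : Integrable k m) (x : G) :
    translateAverage m F k hk x = ∫ y, k y * F (y * x) ∂m := rfl

lemma integrable_mul_translate {m : Measure G} {F : G →ᵇ ℝ} {k : G → ℝ} (hk : Integrable k m)
    (x : G) : Integrable (fun y => k y * F (y * x)) m := by
  exact hk.mul_bdd (c := ‖F‖) (F.continuous.comp (continuous_mul_const x)).aestronglyMeasurable
    (ae_of_all _ fun y => F.norm_coe_le_norm _)

variable [T2Space G] [m.IsHaarMeasure]

lemma integrable_mul_translate' {f g : G → ℝ} (hfc : Continuous f) (hf : HasCompactSupport f)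
    (hgc : Continuous g) (y : G) : Integrable (fun z => f z * g (z * y⁻¹)) m :=
  (hfc.mul (hgc.comp (continuous_mul_const _))).integrable_of_hasCompactSupport hf.mul_right

/-- Integrating the averages with kernels `f · g(· y⁻¹)` over `y` gives a multiple of the average
with kernel `f`. -/
lemma integral_mean_translateAverage [m.IsMulRightInvariant] (M : (G →ᵇ ℝ) →L[ℝ] ℝ) (F : G →ᵇ ℝ)
    {f g : G → ℝ} (hfc : Continuous f) (hf : HasCompactSupport f) (hgc : Continuous g)
    (hg : HasCompactSupport g) :
    ∫ y, M (translateAverage m F (fun z => f z * g (z * y⁻¹))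
      (integrable_mul_translate' m hfc hf hgc y)) ∂m =
    (∫ y, g y ∂m) * M (translateAverage m F f (hfc.integrable_of_hasCompactSupport hf)) := by
  set H : G → (G →ᵇ ℝ) := fun y => translateAverage m F (fun z => f z * g (z * y⁻¹))
      (integrable_mul_translate' m hfc hf hgc y) with hH
  obtain ⟨C, hC⟩ := hgc.bounded_above_of_compact_support hg
  -- Continuity in the sup norm makes `H` Bochner integrable, so `M` can be exchanged with the
  -- integral.
  have hHc : Continuous H := by
    refine continuous_iff_continuousAt.2 fun y₀ => ?_
    refine tendsto_iff_dist_tendsto_zero.2 ?_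
    have hlim : Continuous fun y => (∫ z, ‖f z‖ * ‖g (z * y⁻¹) - g (z * y₀⁻¹)‖ ∂m) * ‖F‖ := by
      refine Continuous.mul ?_ continuous_const
      refine continuous_of_dominated (bound := fun z => ‖f z‖ * (C + C)) (fun y => ?_)
        (fun y => ae_of_all _ fun z => ?_)
        ((hfc.integrable_of_hasCompactSupport hf).norm.mul_const _)
        (ae_of_all _ fun z => by fun_prop)
      · exact Continuous.aestronglyMeasurable (by fun_prop)
      · rw [norm_mul, norm_norm, norm_norm]
        gcongr
        exact (norm_sub_le _ _).trans (add_le_add (hC _) (hC _))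
    have h0 := hlim.tendsto y₀
    simp only [sub_self, norm_zero, mul_zero, integral_zero, zero_mul] at h0
    refine squeeze_zero (fun _ => dist_nonneg) (fun y => ?_) h0
    refine (BoundedContinuousFunction.dist_le (by positivity)).2 fun x => ?_
    rw [hH, dist_eq_norm]
    simp only [translateAverage_apply]
    rw [← integral_sub (integrable_mul_translate (integrable_mul_translate' m hfc hf hgc y) x)
      (integrable_mul_translate (integrable_mul_translate' m hfc hf hgc y₀) x),
      ← integral_mul_const]
    refine norm_integral_le_of_norm_le ?_ (ae_of_all _ fun z => ?_)
    · refine Integrable.mul_const ?_ _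
      refine Continuous.integrable_of_hasCompactSupport (by fun_prop) ?_
      exact hf.norm.mul_right
    · rw [← sub_mul, ← mul_sub, norm_mul, norm_mul]
      gcongr
      exact F.norm_coe_le_norm _
  have hHs : HasCompactSupport H := by
    refine HasCompactSupport.intro (hg.isCompact.inv.mul hf.isCompact) fun y hy => ?_
    ext x
    rw [hH]
    simp only [translateAverage_apply, BoundedContinuousFunction.coe_zero, Pi.zero_apply]
    refine integral_eq_zero_of_ae (ae_of_all _ fun z => ?_)
    by_cases hz : f z = 0
    · simp [hz]
    by_cases hz' : g (z * y⁻¹) = 0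
    · simp [hz']
    refine absurd ⟨(z * y⁻¹)⁻¹, ?_, z, subset_tsupport _ hz, by simp⟩ hy
    simpa using subset_tsupport _ hz'
  have hHi : Integrable H m := hHc.integrable_of_hasCompactSupport hHs
  rw [M.integral_comp_comm hHi]
  have : ∫ y, H y ∂m =
      (∫ y, g y ∂m) • translateAverage m F f (hfc.integrable_of_hasCompactSupport hf) := by
    ext x
    have h1 := (BoundedContinuousFunction.evalCLM ℝ x).integral_comp_comm hHi
    simp only [BoundedContinuousFunction.evalCLM_apply] at h1
    rw [← h1]
    simp only [hH, translateAverage_apply, BoundedContinuousFunction.coe_smul, smul_eq_mul]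
    rw [integral_integral_swap_of_hasCompactSupport]
    · rw [← integral_const_mul]
      congr 1
      ext z
      have : ∀ y, f z * g (z * y⁻¹) * F (z * x) = f z * F (z * x) * g (z * y⁻¹) := fun y => by ring
      simp only [this]
      rw [integral_const_mul]
      have := integral_div_left_eq_self g m z
      simp only [div_eq_mul_inv] at this
      rw [this]; ring
    · simp only [Function.uncurry_def]; fun_prop
    · refine HasCompactSupport.intro ((hg.isCompact.inv.mul hf.isCompact).prod hf.isCompact) ?_
      rintro ⟨y, z⟩ hyz
      simp only [Function.uncurry_apply_pair]
      by_cases hz : f z = 0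
      · simp [hz]
      by_cases hz' : g (z * y⁻¹) = 0
      · simp [hz']
      refine absurd ⟨⟨(z * y⁻¹)⁻¹, ?_, z, subset_tsupport _ hz, by simp⟩,
        subset_tsupport _ hz⟩ hyz
      simpa using subset_tsupport _ hz'
  rw [this, map_smul, smul_eq_mul]

/-- A left-invariant mean is topologically invariant: on averages it only depends on the integral
of the kernel. -/
lemma mean_translateAverage_mul_integral [m.IsMulRightInvariant] (M : (G →ᵇ ℝ) →L[ℝ] ℝ)
    (hM : ∀ (x : G) (f : G →ᵇ ℝ),
      M (f.compContinuous ⟨fun y => x * y, continuous_const_mul x⟩) = M f)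
    (F : G →ᵇ ℝ) {f g : G → ℝ} (hfc : Continuous f) (hf : HasCompactSupport f)
    (hgc : Continuous g) (hg : HasCompactSupport g) :
    (∫ y, g y ∂m) * M (translateAverage m F f (hfc.integrable_of_hasCompactSupport hf)) =
    (∫ y, f y ∂m) * M (translateAverage m F g (hgc.integrable_of_hasCompactSupport hg)) := by
  rw [← integral_mean_translateAverage m M F hfc hf hgc hg,
    ← integral_mean_translateAverage m M F hgc hg hfc hf, ← integral_inv_eq_self]
  congr 1
  ext y
  -- After `y ↦ y⁻¹`, translating by `y` under the mean and substituting `z ↦ z * y⁻¹` exchanges the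
  -- roles of `f` and `g`.
  rw [← hM y]
  congr 1
  ext x
  simp only [BoundedContinuousFunction.compContinuous_apply, ContinuousMap.coe_mk,
    translateAverage_apply, inv_inv]
  rw [← integral_mul_right_eq_self _ y⁻¹]
  congr 1
  ext z
  simp only [mul_assoc, inv_mul_cancel, mul_one, inv_mul_cancel_left]
  ring_nf

end Mean

/-! ### Almost invariant densities -/

section Reiter

variable {G : Type*} [Group G] [TopologicalSpace G] [IsTopologicalGroup G]
  [LocallyCompactSpace G] [SecondCountableTopology G] [MeasurableSpace G] [BorelSpace G]

/-- A continuous compactly supported probability density. -/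
structure IsDensity (m : Measure G) (w : G → ℝ) : Prop where
  continuous : Continuous w
  hasCompactSupport : HasCompactSupport w
  nonneg : ∀ x, 0 ≤ w x
  integral_eq_one : ∫ x, w x ∂m = 1

variable (m : Measure G) [m.IsHaarMeasure]

variable {m} in
lemma IsDensity.integrable {w : G → ℝ} (hw : IsDensity m w) : Integrable w m :=
  hw.continuous.integrable_of_hasCompactSupport hw.hasCompactSupport

lemma exists_isDensity_of_mem_nhds {U : Set G} (hU : U ∈ 𝓝 (1 : G)) :
    ∃ w : G → ℝ, IsDensity m w ∧ tsupport w ⊆ U := by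
  obtain ⟨f, hf1, hfc, hfU, hf⟩ := exists_continuousMap_one_of_isCompact_subset_isOpen
    (isCompact_singleton (x := (1 : G))) (isOpen_interior (s := U))
    (singleton_subset_iff.2 (mem_interior_iff_mem_nhds.2 hU))
  have hpos : 0 < ∫ x, f x ∂m :=
    f.continuous.integral_pos_of_hasCompactSupport_nonneg_nonzero hfc (fun x => (hf x).1)
      (x := 1) (by rw [hf1 (mem_singleton 1)]; exact one_ne_zero)
  refine ⟨fun x => (∫ x, f x ∂m)⁻¹ * f x, ⟨by fun_prop, HasCompactSupport.mul_left hfc,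
    fun x => mul_nonneg (inv_nonneg.2 hpos.le) (hf x).1, ?_⟩, ?_⟩
  · rw [integral_const_mul, inv_mul_cancel₀ hpos.ne']
  · exact (tsupport_mul_subset_right.trans hfU).trans interior_subset

variable {m} in
lemma IsDensity.comp_mul_left {w : G → ℝ} (hw : IsDensity m w) (x : G) :
    IsDensity m fun y => w (x * y) where
  continuous := hw.continuous.comp (continuous_const_mul x)
  hasCompactSupport := hw.hasCompactSupport.comp_homeomorph (Homeomorph.mulLeft x)
  nonneg y := hw.nonneg _
  integral_eq_one := by rw [integral_mul_left_eq_self w x, hw.integral_eq_one]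

/-- The convolution of two functions. -/
noncomputable def conv (k w : G → ℝ) (x : G) : ℝ := ∫ y, k y * w (y⁻¹ * x) ∂m

section conv

variable {m} {k w : G → ℝ}

lemma integrable_conv_integrand (hk : Continuous k) (hks : HasCompactSupport k)
    (hw : Continuous w) (x : G) : Integrable (fun y => k y * w (y⁻¹ * x)) m :=
  Continuous.integrable_of_hasCompactSupport (by fun_prop) hks.mul_right

lemma continuous_conv (hk : Continuous k) (hks : HasCompactSupport k)
    (hw : Continuous w) (hws : HasCompactSupport w) : Continuous (conv m k w) := by
  obtain ⟨C, hC⟩ := hw.bounded_above_of_compact_support hws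
  refine continuous_of_dominated (bound := fun y => ‖k y‖ * C) (fun x => ?_)
    (fun x => ae_of_all _ fun y => ?_)
    ((hk.integrable_of_hasCompactSupport hks).norm.mul_const _)
    (ae_of_all _ fun y => by fun_prop)
  · exact Continuous.aestronglyMeasurable (by fun_prop)
  · rw [norm_mul]; gcongr; exact hC _

lemma hasCompactSupport_conv [T2Space G] (hks : HasCompactSupport k)
    (hws : HasCompactSupport w) : HasCompactSupport (conv m k w) := by
  refine HasCompactSupport.intro (hks.isCompact.mul hws.isCompact) fun x hx => ?_
  refine integral_eq_zero_of_ae (ae_of_all _ fun y => ?_)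
  by_cases hy : k y = 0
  · simp [hy]
  by_cases hy' : w (y⁻¹ * x) = 0
  · simp [hy']
  exact absurd ⟨y, subset_tsupport _ hy, _, subset_tsupport _ hy', by simp⟩ hx

lemma hasCompactSupport_conv_uncurry [T2Space G] (hks : HasCompactSupport k)
    (hws : HasCompactSupport w) :
    HasCompactSupport (Function.uncurry fun x y => k y * w (y⁻¹ * x)) := by
  refine HasCompactSupport.intro ((hks.isCompact.mul hws.isCompact).prod hks.isCompact) ?_
  rintro ⟨x, y⟩ hxy
  simp only [Function.uncurry_apply_pair]
  by_cases hy : k y = 0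
  · simp [hy]
  by_cases hy' : w (y⁻¹ * x) = 0
  · simp [hy']
  exact absurd ⟨⟨y, subset_tsupport _ hy, _, subset_tsupport _ hy', by simp⟩,
    subset_tsupport _ hy⟩ hxy

lemma integral_conv [T2Space G] (hk : Continuous k) (hks : HasCompactSupport k)
    (hw : Continuous w) (hws : HasCompactSupport w) :
    ∫ x, conv m k w x ∂m = (∫ x, k x ∂m) * ∫ x, w x ∂m := by
  unfold conv
  rw [integral_integral_swap_of_hasCompactSupport
    (by simp only [Function.uncurry_def]; fun_prop) (hasCompactSupport_conv_uncurry hks hws),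
    ← integral_mul_const]
  congr 1
  ext y
  rw [integral_const_mul, integral_mul_left_eq_self w]

lemma conv_mul_left (q x : G) :
    conv m k w (q * x) = conv m (fun y => k (q * y)) w x := by
  unfold conv
  rw [← integral_mul_left_eq_self _ q]
  simp [mul_assoc]

lemma setIntegral_conv [T2Space G] (hk : Continuous k) (hks : HasCompactSupport k)
    (hw : Continuous w) (hws : HasCompactSupport w) (s : Set G) :
    ∫ x in s, conv m k w x ∂m = ∫ y, k y * ∫ x in s, w (y⁻¹ * x) ∂m ∂m := by
  unfold conv
  have : IsFiniteMeasureOnCompacts (m.restrict s) := inferInstance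
  rw [integral_integral_swap_of_hasCompactSupport
    (by simp only [Function.uncurry_def]; fun_prop) (hasCompactSupport_conv_uncurry hks hws)]
  congr 1
  ext y
  rw [integral_const_mul]

end conv

/-! ### Convolution as an `L¹`-valued integral, and Day's argument. -/

variable [T2Space G]

/-- Integration over a set, as a functional on `L¹`. -/
noncomputable def setIntegralL1 (s : Set G) : Lp ℝ 1 m →L[ℝ] ℝ :=
  LinearMap.mkContinuous
    { toFun := fun e => ∫ x in s, e x ∂m
      map_add' := fun e f => by
        rw [integral_congr_ae (ae_restrict_of_ae (Lp.coeFn_add e f))]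
        exact integral_add (L1.integrable_coeFn e).integrableOn (L1.integrable_coeFn f).integrableOn
      map_smul' := fun c e => by
        rw [integral_congr_ae (ae_restrict_of_ae (Lp.coeFn_smul c e))]
        exact integral_const_mul c _ } 1
    (fun e => by
      rw [one_mul, L1.norm_eq_integral_norm]
      refine (norm_integral_le_integral_norm _).trans ?_
      exact setIntegral_le_integral (L1.integrable_coeFn e).norm
        (ae_of_all _ fun x => norm_nonneg _))

lemma setIntegralL1_apply (s : Set G) (e : Lp ℝ 1 m) :
    setIntegralL1 m s e = ∫ x in s, e x ∂m := rfl

/-- The class in `L¹` of a density. -/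
noncomputable def IsDensity.toL1 {m : Measure G} [m.IsHaarMeasure] {w : G → ℝ}
    (hw : IsDensity m w) : Lp ℝ 1 m :=
  (memLp_one_iff_integrable.2 hw.integrable).toLp w

lemma IsDensity.mk_smul_toL1 {m : Measure G} [m.IsHaarMeasure] {w : G → ℝ}
    (hw : IsDensity m w) (x : G) :
    DomMulAct.mk x • hw.toL1 = (hw.comp_mul_left x).toL1 :=
  DomMulAct.mk_smul_toLp x _

lemma continuous_mk_smul [m.IsMulRightInvariant] (e : Lp ℝ 1 m) :
    Continuous fun x : G => DomMulAct.mk x⁻¹ • e := by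
  have : Fact ((1 : ℝ≥0∞) ≠ ∞) := ⟨ENNReal.one_ne_top⟩
  have h : Continuous (DomMulAct.mk : G → Gᵈᵐᵃ) := DomMulAct.continuous_mk
  exact (h.comp continuous_inv).smul continuous_const

/-- Convolution from the left by `k`, as a map on `L¹`. -/
noncomputable def convL1 (k : G → ℝ) (e : Lp ℝ 1 m) : Lp ℝ 1 m :=
  ∫ y, k y • (DomMulAct.mk y⁻¹ • e) ∂m

variable [m.IsMulRightInvariant]

variable {m} in
lemma integrable_convL1 {k : G → ℝ} (hk : Continuous k) (hks : HasCompactSupport k)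
    (e : Lp ℝ 1 m) : Integrable (fun y => k y • (DomMulAct.mk y⁻¹ • e)) m :=
  (hk.smul (continuous_mk_smul m e)).integrable_of_hasCompactSupport hks.smul_right

-- The Bochner integral in `L¹` is identified with the pointwise convolution by comparing integrals
-- over all measurable sets: each such integral is a continuous functional.
variable {m} in
lemma integral_norm_conv_eq {k w : G → ℝ} (hk : Continuous k) (hks : HasCompactSupport k)
    (hw : IsDensity m w) :
    ∫ x, ‖conv m k w x‖ ∂m = ‖convL1 m k hw.toL1‖ := by
  have hc := continuous_conv (m := m) hk hks hw.continuous hw.hasCompactSupport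
  have hcs := hasCompactSupport_conv (m := m) hks hw.hasCompactSupport
  rw [L1.norm_eq_integral_norm]
  have : (convL1 m k hw.toL1 : G → ℝ) =ᵐ[m] conv m k w := by
    refine Integrable.ae_eq_of_forall_setIntegral_eq _ _ (L1.integrable_coeFn _)
      (hc.integrable_of_hasCompactSupport hcs) fun s hs _ => ?_
    rw [← setIntegralL1_apply, convL1,
      ← (setIntegralL1 m s).integral_comp_comm (integrable_convL1 hk hks _),
      setIntegral_conv hk hks hw.continuous hw.hasCompactSupport]
    congr 1
    ext y
    rw [map_smul, smul_eq_mul, hw.mk_smul_toL1, setIntegralL1_apply]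
    congr 1
    exact integral_congr_ae (ae_restrict_of_ae (MemLp.coeFn_toLp _))
  refine integral_congr_ae ?_
  filter_upwards [this] with x hx
  rw [hx]

/-- Day's argument: if `G` is amenable, then convolutions of suitable densities with finitely many
kernels of integral zero are small. -/
lemma exists_isDensity_integral_norm_conv_lt (hG : IsAmenable G) {ι : Type*} [Fintype ι]
    {k : ι → G → ℝ} (hk : ∀ i, Continuous (k i)) (hks : ∀ i, HasCompactSupport (k i))
    (hk0 : ∀ i, ∫ x, k i x ∂m = 0) {δ : ℝ} (hδ : 0 < δ) :
    ∃ w, IsDensity m w ∧ ∀ i, ∫ x, ‖conv m (k i) w x‖ ∂m < δ := by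
  classical
  obtain ⟨M₀, hM0, hM1, hMinv⟩ := hG
  have hMb : ∀ f : G →ᵇ ℝ, ‖M₀ f‖ ≤ 1 * ‖f‖ := by
    have hle : ∀ f : G →ᵇ ℝ, M₀ f ≤ ‖f‖ := by
      intro f
      have := hM0 (‖f‖ • BoundedContinuousFunction.const G 1 - f) fun y => by
        simpa using (le_abs_self _).trans (f.norm_coe_le_norm y)
      rw [map_sub, map_smul, hM1] at this
      simpa using this
    intro f
    rw [one_mul, Real.norm_eq_abs, abs_le]
    refine ⟨?_, hle f⟩
    have := hle (-f)
    rw [map_neg, norm_neg] at this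
    linarith
  set M : (G →ᵇ ℝ) →L[ℝ] ℝ := M₀.mkContinuous 1 hMb with hM
  obtain ⟨h, hh, -⟩ := exists_isDensity_of_mem_nhds m (U := univ) Filter.univ_mem
  set A : G → Lp ℝ 1 m := fun x => DomMulAct.mk x⁻¹ • hh.toL1 with hA
  have hAc : Continuous A := continuous_mk_smul m _
  let B : Lp ℝ 1 m →ₗ[ℝ] (ι → Lp ℝ 1 m) :=
    { toFun := fun e i => convL1 m (k i) e
      map_add' := fun e f => by
        ext1 i
        simp only [convL1, smul_add, Pi.add_apply]
        exact integral_add (integrable_convL1 (hk i) (hks i) e)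
          (integrable_convL1 (hk i) (hks i) f)
      map_smul' := fun c e => by
        ext1 i
        simp only [convL1, RingHom.id_apply, Pi.smul_apply]
        rw [← integral_smul]
        congr 1
        ext1 y
        rw [smul_comm (DomMulAct.mk y⁻¹) c e, smul_comm] }
  have hcl : (0 : ι → Lp ℝ 1 m) ∈ closure (B '' convexHull ℝ (range A)) := by
    by_contra hcon
    -- A separating functional would satisfy `f (B (A x)) > u > 0` for all `x`. But this function of
    -- `x` is a sum of averages with kernels of integral zero, on which the mean vanishes, while the
    -- mean must be at least `u`.
    obtain ⟨f, u, hu0, hu⟩ := geometric_hahn_banach_point_closed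
      (((convex_convexHull ℝ (range A)).linear_image B).closure) isClosed_closure hcon
    rw [map_zero] at hu0
    let F : ι → (G →ᵇ ℝ) := fun i => BoundedContinuousFunction.ofNormedAddCommGroup
      (fun x => f (Pi.single i (A x)))
      (f.continuous.comp ((continuous_single i).comp hAc)) (‖f‖ * ‖hh.toL1‖) (fun x => by
        refine (f.le_opNorm _).trans ?_
        rw [Pi.norm_single, hA, DomMulAct.norm_smul_Lp])
    let T : G →ᵇ ℝ := ∑ i, translateAverage m (F i) (k i)
      ((hk i).integrable_of_hasCompactSupport (hks i))
    have hT : ∀ x, T x = f (B (A x)) := by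
      intro x
      have h1 : f (B (A x)) = ∑ i, f (Pi.single i (convL1 m (k i) (A x))) := by
        rw [← map_sum, Finset.univ_sum_single (fun i => convL1 m (k i) (A x))]
        rfl
      rw [h1]
      simp only [T, BoundedContinuousFunction.coe_sum, Finset.sum_apply]
      refine Finset.sum_congr rfl fun i _ => ?_
      rw [translateAverage_apply, convL1]
      have := (f.comp (ContinuousLinearMap.single ℝ (fun _ : ι => Lp ℝ 1 m) i)).integral_comp_comm
        (integrable_convL1 (hk i) (hks i) (A x))
      simp only [ContinuousLinearMap.comp_apply, ContinuousLinearMap.single_apply] at this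
      rw [← this]
      congr 1
      ext y
      rw [Pi.single_smul, map_smul, smul_eq_mul]
      congr 1
      change f (Pi.single i (A (y * x))) = _
      congr 2
      rw [hA]
      simp only [mul_inv_rev, DomMulAct.mk_mul, mul_smul]
    have hM0' : M T = 0 := by
      simp only [T, map_sum]
      refine Finset.sum_eq_zero fun i _ => ?_
      have := mean_translateAverage_mul_integral m M hMinv (F i) (hk i) (hks i) hh.continuous
        hh.hasCompactSupport
      rwa [hh.integral_eq_one, one_mul, hk0 i, zero_mul] at this
    have hpos : 0 ≤ M₀ (T - u • BoundedContinuousFunction.const G 1) := hM0 _ fun x => by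
      have := hu _ (subset_closure ⟨A x, subset_convexHull ℝ _ ⟨x, rfl⟩, rfl⟩)
      simp only [BoundedContinuousFunction.coe_sub, BoundedContinuousFunction.coe_smul,
        Pi.sub_apply, BoundedContinuousFunction.const_apply, smul_eq_mul, mul_one, hT x]
      linarith
    rw [map_sub, map_smul, hM1] at hpos
    have : M₀ T = 0 := hM0'
    rw [this, smul_eq_mul] at hpos
    linarith
  obtain ⟨_, ⟨e, he, rfl⟩, hd⟩ := Metric.mem_closure_iff.1 hcl δ hδ
  -- Convex combinations of translates of `h` are again classes of continuous compactly supported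
  -- densities.
  have hrep : convexHull ℝ (range A) ⊆ {e | ∃ w, ∃ hw : IsDensity m w, e = hw.toL1} := by
    refine convexHull_min ?_ ?_
    · rintro _ ⟨x, rfl⟩
      exact ⟨_, hh.comp_mul_left x⁻¹, hh.mk_smul_toL1 _⟩
    · rintro _ ⟨w, hw, rfl⟩ _ ⟨w', hw', rfl⟩ a b ha hb hab
      refine ⟨a • w + b • w', ⟨?_, ?_, ?_, ?_⟩, ?_⟩
      · exact (hw.continuous.const_smul a).add (hw'.continuous.const_smul b)
      · exact (hw.hasCompactSupport.smul_left).add (hw'.hasCompactSupport.smul_left)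
      · exact fun x => add_nonneg (mul_nonneg ha (hw.nonneg x)) (mul_nonneg hb (hw'.nonneg x))
      · simp only [Pi.add_apply, Pi.smul_apply, smul_eq_mul]
        rw [integral_add (hw.integrable.const_mul a) (hw'.integrable.const_mul b),
          integral_const_mul, integral_const_mul, hw.integral_eq_one, hw'.integral_eq_one]
        simpa using hab
      · rfl
  obtain ⟨w, hw, rfl⟩ := hrep he
  refine ⟨w, hw, fun i => ?_⟩
  rw [integral_norm_conv_eq (hk i) (hks i) hw]
  rw [dist_zero_left] at hd
  exact (norm_le_pi_norm (B hw.toL1) i).trans_lt hd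

end Reiter

/-! ### Følner sets -/

section Folner

variable {G : Type*} [Group G] [TopologicalSpace G] [IsTopologicalGroup G] [T2Space G]
  [LocallyCompactSpace G]

/-- Left translates of a continuous compactly supported function by elements of a compact set are
uniformly approximated by finitely many of them. -/
lemma exists_finset_translate_approx {k : G → ℝ} (hk : Continuous k) (hks : HasCompactSupport k)
    {Q : Set G} (hQ : IsCompact Q) :
    ∃ χ : G → ℝ, Continuous χ ∧ HasCompactSupport χ ∧ (∀ y, 0 ≤ χ y) ∧
      ∀ η > 0, ∃ t : Finset G, ∀ q ∈ Q, ∃ p ∈ t, ∀ y, |k (q * y) - k (p * y)| ≤ η * χ y := by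
  set B : Set G := Q⁻¹ * tsupport k with hBdef
  have hB : IsCompact B := hQ.inv.mul hks.isCompact
  obtain ⟨χ, h1, h2, -, h3⟩ := exists_continuousMap_one_of_isCompact_subset_isOpen hB isOpen_univ
    (subset_univ B)
  refine ⟨χ, χ.continuous, h2, fun y => (h3 y).1, fun η hη => ?_⟩
  have : CompactSpace B := isCompact_iff_compactSpace.1 hB
  -- Restriction to `B` depends continuously on the translation in sup norm, so `Q` has a finite
  -- net. Outside `B` all translates by elements of `Q` vanish.
  let Φ : C(G, C(B, ℝ)) := ContinuousMap.curry ⟨fun p : G × B => k (p.1 * p.2), by fun_prop⟩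
  obtain ⟨t, htQ, ht⟩ := hQ.elim_nhds_subcover (fun p => {q | dist (Φ q) (Φ p) < η}) fun p _ =>
    (isOpen_lt (by fun_prop) continuous_const).mem_nhds (by simpa using hη)
  refine ⟨t, fun q hq => ?_⟩
  obtain ⟨p, hp, hqp⟩ := mem_iUnion₂.1 (ht hq)
  refine ⟨p, hp, fun y => ?_⟩
  by_cases hy : y ∈ B
  · rw [h1 hy, Pi.one_apply, mul_one]
    exact (ContinuousMap.dist_apply_le_dist (f := Φ q) (g := Φ p) ⟨y, hy⟩).trans hqp.le
  · have hzero : ∀ q ∈ Q, k (q * y) = 0 := fun q hq => by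
      by_contra hne
      exact hy ⟨q⁻¹, inv_mem_inv.2 hq, q * y, subset_tsupport _ hne, by simp⟩
    rw [hzero q hq, hzero p (htQ p hp)]
    simpa using mul_nonneg hη.le (h3 y).1

variable [SecondCountableTopology G] [MeasurableSpace G] [BorelSpace G]
  (m : Measure G) [m.IsHaarMeasure] [m.IsMulRightInvariant]

/-- In an amenable group there are densities that are almost invariant, uniformly over compact
sets of translations. -/
lemma exists_isDensity_almost_invariant (hG : IsAmenable G) {Q : Set G} (hQ : IsCompact Q)
    {ε : ℝ} (hε : 0 < ε) :
    ∃ w ψ : G → ℝ, IsDensity m w ∧ Integrable ψ m ∧ (∀ x, 0 ≤ ψ x) ∧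
      (∀ q ∈ Q, ∀ x, w (q * x) ≤ ψ x) ∧ ∫ x, ψ x ∂m ≤ 1 + ε := by
  obtain ⟨k, hk, -⟩ := exists_isDensity_of_mem_nhds m (U := (univ : Set G)) Filter.univ_mem
  obtain ⟨χ, hχ, hχs, hχ0, hnet⟩ :=
    exists_finset_translate_approx hk.continuous hk.hasCompactSupport hQ
  have hI : 0 ≤ ∫ x, χ x ∂m := integral_nonneg hχ0
  -- The error `ε` is split in two: `η` pays for replacing a translation by one in the finite net,
  -- `δ` for the translations in the net.
  obtain ⟨η, hη, hηε⟩ : ∃ η > 0, η * ∫ x, χ x ∂m ≤ ε / 2 := by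
    refine ⟨ε / 2 / (1 + ∫ x, χ x ∂m), by positivity, ?_⟩
    rw [div_mul_eq_mul_div, div_le_iff₀ (by positivity)]
    gcongr
    linarith
  obtain ⟨t, ht⟩ := hnet η hη
  obtain ⟨δ, hδ, hδε⟩ : ∃ δ > 0, t.card * δ ≤ ε / 2 := by
    refine ⟨ε / 2 / (1 + t.card), by positivity, ?_⟩
    rw [mul_div_assoc', div_le_iff₀ (by positivity), mul_comm]
    gcongr
    linarith
  have hkp : ∀ p : G, IsDensity m fun y => k (p * y) := fun p => hk.comp_mul_left p
  have hdc : ∀ p : G, Continuous fun y => k (p * y) - k y := fun p =>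
    (hkp p).continuous.sub hk.continuous
  have hds : ∀ p : G, HasCompactSupport fun y => k (p * y) - k y := fun p =>
    (hkp p).hasCompactSupport.sub hk.hasCompactSupport
  obtain ⟨w, hw, hwδ⟩ := exists_isDensity_integral_norm_conv_lt m hG (ι := t)
    (k := fun p y => k ((p : G) * y) - k y) (fun p => hdc p) (fun p => hds p)
    (fun p => by
      rw [integral_sub (hkp p).integrable hk.integrable, (hkp p).integral_eq_one,
        hk.integral_eq_one, sub_self]) hδ
  have hcc : ∀ f : G → ℝ, Continuous f → HasCompactSupport f → Integrable (conv m f w) m :=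
    fun f hf hfs => (continuous_conv hf hfs hw.continuous
      hw.hasCompactSupport).integrable_of_hasCompactSupport
        (hasCompactSupport_conv hfs hw.hasCompactSupport)
  have hconv0 : ∀ f : G → ℝ, (∀ y, 0 ≤ f y) → ∀ x, 0 ≤ conv m f w x := fun f hf x =>
    integral_nonneg fun y => mul_nonneg (hf y) (hw.nonneg _)
  have hi : ∀ {f : G → ℝ}, Continuous f → HasCompactSupport f → ∀ x,
      Integrable (fun y => f y * w (y⁻¹ * x)) m := fun hf hfs x =>
    integrable_conv_integrand hf hfs hw.continuous x
  -- The majorant serves all `q ∈ Q` at once: `k (q * ·)` is within `η * χ` of some `k (p * ·)`, and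
  -- the sum over the whole net covers whichever `p` occurs.
  refine ⟨conv m k w, fun x => conv m k w x +
    (∑ p ∈ t, ‖conv m (fun y => k (p * y) - k y) w x‖) + η * conv m χ w x, ⟨?_, ?_, ?_, ?_⟩,
    ?_, ?_, ?_, ?_⟩
  · exact continuous_conv hk.continuous hk.hasCompactSupport hw.continuous hw.hasCompactSupport
  · exact hasCompactSupport_conv hk.hasCompactSupport hw.hasCompactSupport
  · exact hconv0 k hk.nonneg
  · rw [integral_conv hk.continuous hk.hasCompactSupport hw.continuous hw.hasCompactSupport,
      hk.integral_eq_one, hw.integral_eq_one, one_mul]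
  · exact ((hcc k hk.continuous hk.hasCompactSupport).add
      (integrable_finsetSum _ fun p _ => (hcc _ (hdc p) (hds p)).norm)).add
      ((hcc χ hχ hχs).const_mul η)
  · intro x
    have := hconv0 k hk.nonneg x
    have := hconv0 χ hχ0 x
    positivity
  · intro q hq x
    obtain ⟨p, hp, hpq⟩ := ht q hq
    rw [conv_mul_left]
    have h1 : conv m (fun y => k (q * y)) w x ≤ conv m k w x +
        conv m (fun y => k (p * y) - k y) w x + η * conv m χ w x := by
      have i1 := hi hk.continuous hk.hasCompactSupport x
      have i2 := hi (hdc p) (hds p) x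
      have i3 := (hi hχ hχs x).const_mul η
      have i4 : Integrable (fun y => k y * w (y⁻¹ * x) + (k (p * y) - k y) * w (y⁻¹ * x)) m :=
        i1.add i2
      unfold conv
      rw [← integral_const_mul, ← integral_add i1 i2, ← integral_add i4 i3]
      refine integral_mono (hi (hkp q).continuous (hkp q).hasCompactSupport x)
        (i4.add i3) fun y => ?_
      have h2 := (abs_le.1 (hpq y)).2
      have h3 := hw.nonneg (y⁻¹ * x)
      beta_reduce
      nlinarith
    refine h1.trans ?_
    refine add_le_add_left (add_le_add_right ?_ _) _
    exact (le_abs_self _).trans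
      (Finset.single_le_sum (f := fun p => ‖conv m (fun y => k (p * y) - k y) w x‖)
        (fun _ _ => norm_nonneg _) hp)
  · have i1 := hcc k hk.continuous hk.hasCompactSupport
    have i2 : Integrable (fun x => ∑ p ∈ t, ‖conv m (fun y => k (p * y) - k y) w x‖) m :=
      integrable_finsetSum _ fun p _ => (hcc _ (hdc p) (hds p)).norm
    have i3 := (hcc χ hχ hχs).const_mul η
    have i4 : Integrable (fun x => conv m k w x +
      ∑ p ∈ t, ‖conv m (fun y => k (p * y) - k y) w x‖) m := i1.add i2
    rw [integral_add i4 i3, integral_add i1 i2,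
      integral_finsetSum _ (fun p _ => (hcc _ (hdc p) (hds p)).norm), integral_const_mul,
      integral_conv hk.continuous hk.hasCompactSupport hw.continuous hw.hasCompactSupport,
      integral_conv hχ hχs hw.continuous hw.hasCompactSupport, hk.integral_eq_one,
      hw.integral_eq_one, mul_one, mul_one]
    have : ∑ p ∈ t, ∫ x, ‖conv m (fun y => k (p * y) - k y) w x‖ ∂m ≤ t.card * δ := by
      rw [← nsmul_eq_mul]
      exact Finset.sum_le_card_nsmul _ _ _ fun p hp => (hwδ ⟨p, hp⟩).le
    linarith

/-- Existence of compact Følner sets, for multiplication from the left. -/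
lemma exists_isCompact_measure_mul_le (hG : IsAmenable G) {Q : Set G} (hQ : IsCompact Q)
    {ε : ℝ} (hε : 0 < ε) :
    ∃ K : Set G, IsCompact K ∧ 0 < m K ∧ m (Q * K) ≤ ENNReal.ofReal (1 + ε) * m K := by
  by_contra! hcon
  obtain ⟨w, ψ, hw, hψ, hψ0, hwψ, hψε⟩ :=
    exists_isDensity_almost_invariant m hG hQ.inv (half_pos hε)
  -- Layer cake: `Q` maps each superlevel set of `w` into that of `ψ`. If every compact set grew by
  -- the factor `1 + ε`, so would the integral, yet that of `ψ` is at most `1 + ε / 2`.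
  have hlow : ENNReal.ofReal (1 + ε) * ∫⁻ x, ENNReal.ofReal (w x) ∂m ≤
      ∫⁻ x, ENNReal.ofReal (ψ x) ∂m := by
    rw [lintegral_eq_lintegral_meas_le m (ae_of_all _ hw.nonneg)
      hw.continuous.measurable.aemeasurable, lintegral_eq_lintegral_meas_le m (ae_of_all _ hψ0)
      hψ.aemeasurable, ← lintegral_const_mul' _ _ ENNReal.ofReal_ne_top]
    refine setLIntegral_mono' measurableSet_Ioi fun s hs => ?_
    have hK : IsCompact {x | s ≤ w x} := by
      refine hw.hasCompactSupport.isCompact.of_isClosed_subset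
        (isClosed_le continuous_const hw.continuous) fun x hx => subset_tsupport _ ?_
      exact (lt_of_lt_of_le (mem_Ioi.1 hs) hx).ne'
    rcases (zero_le (a := m {x | s ≤ w x})).eq_or_lt with h0 | h0
    · rw [← h0, mul_zero]
      exact bot_le
    · refine (hcon _ hK h0).le.trans (measure_mono ?_)
      rintro _ ⟨q, hq, x, hx, rfl⟩
      refine le_trans (show s ≤ w x from hx) ?_
      simpa using hwψ q⁻¹ (inv_mem_inv.2 hq) (q * x)
  rw [← ofReal_integral_eq_lintegral_ofReal hw.integrable (ae_of_all _ hw.nonneg),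
    ← ofReal_integral_eq_lintegral_ofReal hψ (ae_of_all _ hψ0), hw.integral_eq_one,
    ENNReal.ofReal_one, mul_one, ENNReal.ofReal_le_ofReal_iff (integral_nonneg hψ0)] at hlow
  linarith

/-- Existence of compact Følner sets, for multiplication from the right. -/
lemma exists_isCompact_measure_mul_le' (hG : IsAmenable G) {Q : Set G} (hQ : IsCompact Q)
    {ε : ℝ} (hε : 0 < ε) :
    ∃ K : Set G, IsCompact K ∧ 0 < m K ∧ m (K * Q) ≤ ENNReal.ofReal (1 + ε) * m K := by
  obtain ⟨K, hK, hK0, hle⟩ := exists_isCompact_measure_mul_le m hG hQ.inv hε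
  refine ⟨K⁻¹, hK.inv, by rwa [Measure.measure_inv], ?_⟩
  rw [← Measure.measure_inv m (K⁻¹ * Q), mul_inv_rev, inv_inv, Measure.measure_inv]
  exact hle

end Folner

/-! ### Relatively separated sets -/

section Counting

variable {G : Type*} [Group G]

lemma encard_smul_inter_smul (Λ K : Set G) (x y : G) :
    (x • Λ ∩ y • K).encard = (Λ ∩ (x⁻¹ * y) • K).encard := by
  rw [← (MulAction.injective x).encard_image (Λ ∩ (x⁻¹ * y) • K)]
  change _ = (x • (Λ ∩ (x⁻¹ * y) • K)).encard
  rw [smul_set_inter, smul_smul, mul_inv_cancel_left]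

lemma tsum_indicator_one {X : Type*} (A K : Set X) :
    ∑' p : A, K.indicator (1 : X → ℝ≥0∞) p = ((A ∩ K).encard : ℝ≥0∞) := by
  rw [tsum_subtype A (K.indicator (1 : X → ℝ≥0∞)), indicator_indicator, ← tsum_subtype]
  exact ENNReal.tsum_set_one _

lemma tsum_smul_set (φ : G → ℝ≥0∞) (x : G) (A : Set G) :
    ∑' p : (x • A : Set G), φ p = ∑' p : A, φ (x * p) :=
  tsum_image φ (MulAction.injective x).injOn

lemma tsum_le_encard_mul {X : Type*} {φ : X → ℝ≥0∞} {A K : Set X} {c : ℝ≥0∞}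
    (hK : ∀ p, p ∉ K → φ p = 0) (hc : ∀ p ∈ A, φ p ≤ c) :
    ∑' p : A, φ p ≤ ((A ∩ K).encard : ℝ≥0∞) * c := by
  rw [← tsum_indicator_one, ← ENNReal.tsum_mul_right]
  refine ENNReal.tsum_le_tsum fun p => ?_
  by_cases hp : (p : X) ∈ K
  · rw [indicator_of_mem hp, Pi.one_apply, one_mul]
    exact hc p p.2
  · rw [hK _ hp]
    exact bot_le

end Counting

/-! ### Finiteness properties of relatively separated sets. -/

section RelativelySeparated

variable {G : Type*} [Group G] [TopologicalSpace G] {Λ : Set G}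

lemma one_le_rel (h : Λ.Nonempty) : 1 ≤ rel Λ := by
  obtain ⟨p, hp⟩ := h
  refine le_iInf₂ fun U hU => le_iSup_of_le p ?_
  rw [one_le_encard_iff_nonempty]
  exact ⟨p, hp, 1, mem_of_mem_nhds hU, mul_one p⟩

lemma IsSeparated.rel_le_one (h : IsSeparated Λ) : rel Λ ≤ 1 := by
  obtain ⟨U, hU, h⟩ := h
  exact iInf₂_le_of_le U hU (iSup_le h)

/-- The infimum defining `rel Λ` is attained, because a value in `ℕ∞` below `rel Λ + 1` is at most
`rel Λ`. -/
lemma IsRelativelySeparated.exists_nhds (h : IsRelativelySeparated Λ) :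
    ∃ U : Set G, IsOpen U ∧ (1 : G) ∈ U ∧ ∀ x : G, (Λ ∩ x • U).encard ≤ rel Λ := by
  have h1 : rel Λ < rel Λ + 1 := ENat.lt_add_one_iff h.ne |>.2 le_rfl
  obtain ⟨U, hU, hlt⟩ : ∃ U ∈ 𝓝 (1 : G), ⨆ x : G, (Λ ∩ x • U).encard < rel Λ + 1 := by
    conv_lhs at h1 => rw [rel]
    simpa only [iInf_lt_iff, exists_prop] using h1
  obtain ⟨V, hVU, hV, h1V⟩ := mem_nhds_iff.1 hU
  refine ⟨V, hV, h1V, fun x => ?_⟩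
  refine (encard_le_encard (inter_subset_inter_right _ (smul_set_mono hVU))).trans ?_
  exact (le_iSup (fun x : G => (Λ ∩ x • U).encard) x).trans
    ((ENat.lt_add_one_iff h.ne).1 hlt)

variable [IsTopologicalGroup G]

/-- A relatively separated set has boundedly many points in the translates of a compact set. -/
lemma IsRelativelySeparated.exists_encard_le (h : IsRelativelySeparated Λ) {K : Set G}
    (hK : IsCompact K) : ∃ N : ℕ, ∀ x : G, (Λ ∩ x • K).encard ≤ N := by
  obtain ⟨U, hU, h1, hcard⟩ := h.exists_nhds
  refine hK.induction_on (p := fun K => ∃ N : ℕ, ∀ x : G, (Λ ∩ x • K).encard ≤ N)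
    ⟨0, by simp⟩ ?_ ?_ ?_
  · rintro S T hST ⟨N, hN⟩
    exact ⟨N, fun x => (encard_le_encard
      (inter_subset_inter_right _ (smul_set_mono hST))).trans (hN x)⟩
  · rintro S T ⟨N, hN⟩ ⟨M, hM⟩
    refine ⟨N + M, fun x => ?_⟩
    rw [smul_set_union, inter_union_distrib_left, Nat.cast_add]
    exact (encard_union_le _ _).trans (add_le_add (hN x) (hM x))
  · intro z _
    refine ⟨z • U, mem_nhdsWithin_of_mem_nhds ((hU.smul z).mem_nhds ⟨1, h1, mul_one z⟩),
      (rel Λ).toNat, fun x => ?_⟩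
    rw [smul_smul, ENat.natCast_toNat h.ne]
    exact hcard _

lemma IsRelativelySeparated.finite_inter (h : IsRelativelySeparated Λ) {K : Set G}
    (hK : IsCompact K) : (Λ ∩ K).Finite := by
  obtain ⟨N, hN⟩ := h.exists_encard_le hK
  have := hN 1
  rw [one_smul] at this
  exact finite_of_encard_le_coe this

lemma IsRelativelySeparated.isClosed [T1Space G] (h : IsRelativelySeparated Λ) : IsClosed Λ := by
  obtain ⟨U, hU, h1, hcard⟩ := h.exists_nhds
  refine isOpen_compl_iff.1 (isOpen_iff_mem_nhds.2 fun x hx => ?_)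
  have hfin : (Λ ∩ x • U).Finite := finite_of_encard_le_coe
    ((hcard x).trans (ENat.natCast_toNat h.ne).symm.le)
  filter_upwards [(hU.smul x).mem_nhds ⟨1, h1, mul_one x⟩,
    hfin.isClosed.isOpen_compl.mem_nhds fun hx' => hx hx'.1] with y hyU hy hyΛ
  exact hy ⟨hyΛ, hyU⟩

lemma IsRelativelySeparated.countable [SigmaCompactSpace G] (h : IsRelativelySeparated Λ) :
    Λ.Countable := by
  have : Λ = ⋃ n, Λ ∩ compactCovering G n := by
    rw [← inter_iUnion, iUnion_compactCovering, inter_univ]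
  rw [this]
  exact countable_iUnion fun n => (h.finite_inter (isCompact_compactCovering G n)).countable

end RelativelySeparated

/-! ### The hull -/

section Hull

variable {G : Type*} [Group G] [TopologicalSpace G] {Λ : Set G}

lemma isClosed_hull : IsClosed (hull Λ) := isClosed_closure

variable [IsTopologicalGroup G]

/-- Sublevel sets of a lower semicontinuous function are closed, so the bound passes from the orbit
to its closure. -/
lemma tsum_le_of_mem_hull [T2Space G] {φ : G → ℝ≥0∞} (hφ : Continuous φ) {c : ℝ≥0∞}
    (h : ∀ x : G, ∑' p : (x • Λ : Set G), φ p ≤ c) {P : ClosedSubsets G} (hP : P ∈ hull Λ) :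
    ∑' p : P.carrier, φ p ≤ c := by
  refine closure_minimal ?_ ((lowerSemicontinuous_tsum hφ).isClosed_preimage c) hP
  rintro C ⟨x, hx⟩
  change ∑' p : C.carrier, φ p ≤ c
  rw [hx]
  exact h x

/-- Passing to a limit in the hull, at most `rel Λ` points can merge into one. -/
lemma le_rel_mul_tsum_of_mem_hull [T2Space G] [LocallyCompactSpace G]
    (hΛ : IsRelativelySeparated Λ) {φ : G → ℝ≥0} (hφ : Continuous φ) (hφs : HasCompactSupport φ)
    {c : ℝ≥0∞} (h : ∀ x : G, c ≤ ∑' p : (x • Λ : Set G), (φ p : ℝ≥0∞))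
    {P : ClosedSubsets G} (hP : P ∈ hull Λ) :
    c ≤ ((rel Λ : ℕ∞) : ℝ≥0∞) * ∑' p : P.carrier, (φ p : ℝ≥0∞) := by
  obtain ⟨U, hU, h1, hcard⟩ := hΛ.exists_nhds
  obtain ⟨t, -, ht⟩ := hφs.isCompact.elim_nhds_subcover (fun z => z • U)
    fun z _ => (hU.smul z).mem_nhds ⟨1, h1, mul_one z⟩
  -- The partition of unity cuts `φ` into pieces living on translates of `U`, each holding at most
  -- `rel Λ` points of any translate of `Λ`.
  obtain ⟨ρ, hρU, hρ1, hρ, -⟩ := exists_continuous_sum_one_of_isOpen_isCompact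
    (s := fun i : Fin t.card => ((t.equivFin.symm i : G)) • U) (fun i => hU.smul _) hφs.isCompact
    (by
      refine ht.trans fun y hy => ?_
      obtain ⟨z, hz, hy⟩ := mem_iUnion₂.1 hy
      exact mem_iUnion.2 ⟨t.equivFin ⟨z, hz⟩, by simpa using hy⟩)
  let φ' : Fin t.card → G → ℝ≥0∞ := fun i y => (φ y : ℝ≥0∞) * ENNReal.ofReal (ρ i y)
  have hφ'c : ∀ i, Continuous (φ' i) := fun i => by
    have : φ' i = fun y => ((φ y * (ρ i y).toNNReal : ℝ≥0) : ℝ≥0∞) := by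
      ext y; simp [φ', ENNReal.ofReal]
    rw [this]
    fun_prop
  have hφ's : ∀ i, HasCompactSupport (φ' i) := fun i =>
    (hφs.comp_left (g := ((↑) : ℝ≥0 → ℝ≥0∞)) rfl).mul_right
  have hφ'sum : ∀ y, (φ y : ℝ≥0∞) = ∑ i, φ' i y := by
    intro y
    simp only [φ']
    rw [← Finset.mul_sum, ← ENNReal.ofReal_sum_of_nonneg fun i _ => (hρ i y).1]
    by_cases hy : y ∈ tsupport φ
    · have := hρ1 hy
      simp only [Finset.sum_apply, Pi.one_apply] at this
      rw [this, ENNReal.ofReal_one, mul_one]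
    · rw [image_eq_zero_of_notMem_tsupport hy]; simp
  have hsum : ∀ A : Set G, ∑' p : A, (φ p : ℝ≥0∞) = ∑ i, ∑' p : A, φ' i p := fun A => by
    rw [← Summable.tsum_finsetSum fun _ _ => ENNReal.summable]
    exact tsum_congr fun p => hφ'sum p
  -- Sums are only lower semicontinuous, so each is traded for a supremum, which is continuous. On
  -- the orbit a sum is at most `rel Λ` times the supremum; in the limit the supremum is at most the
  -- sum.
  have hcont : Continuous fun P : ClosedSubsets G =>
      ((rel Λ : ℕ∞) : ℝ≥0∞) * ∑ i, ⨆ x ∈ P.carrier, φ' i x :=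
    (ENNReal.continuous_const_mul (by simpa using hΛ.ne)).comp
      (continuous_finsetSum _ fun i _ => continuous_biSup (hφ'c i) (hφ's i))
  have hle : c ≤ ((rel Λ : ℕ∞) : ℝ≥0∞) * ∑ i, ⨆ x ∈ P.carrier, φ' i x := by
    refine closure_minimal ?_ (isClosed_le continuous_const hcont) hP
    rintro C ⟨x, hx⟩
    change c ≤ ((rel Λ : ℕ∞) : ℝ≥0∞) * ∑ i, ⨆ x ∈ C.carrier, φ' i x
    rw [hx]
    refine (h x).trans ?_
    rw [hsum, Finset.mul_sum]
    refine Finset.sum_le_sum fun i _ => ?_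
    refine (tsum_le_encard_mul (K := (t.equivFin.symm i : G) • U)
      (c := ⨆ y ∈ (x • Λ : Set G), φ' i y) (fun p hp => ?_)
      (fun p hp => le_iSup₂ (f := fun y (_ : y ∈ (x • Λ : Set G)) => φ' i y) p hp)).trans ?_
    · simp only [φ', image_eq_zero_of_notMem_tsupport fun h => hp (hρU i h), ENNReal.ofReal_zero,
        mul_zero]
    · gcongr
      rw [encard_smul_inter_smul]
      exact hcard _
  refine hle.trans ?_
  rw [hsum]
  gcongr with i
  exact iSup₂_le fun x hx => ENNReal.le_tsum (f := fun p : P.carrier => φ' i p) ⟨x, hx⟩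

lemma ae_mem_hull [MeasurableSpace G] {m : Measure G} {μ : Measure (ClosedSubsets G)}
    (hμ : IsNormalizedHullMeasure m Λ μ) : ∀ᵐ P ∂μ, P ∈ hull Λ :=
  measure_mono_null (compl_subset_compl.2 sdiff_subset) hμ.concentrated

lemma measure_puncturedHull [MeasurableSpace G] {m : Measure G} {μ : Measure (ClosedSubsets G)}
    (hμ : IsNormalizedHullMeasure m Λ μ) : μ (puncturedHull Λ) = μ univ :=
  measure_congr (Filter.eventuallyEq_univ.2 (mem_ae_iff.2 hμ.concentrated))

end Hull

/-! ### Bounds for the mass of a normalized hull measure -/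

section MassBounds

variable {G : Type*} [Group G] [TopologicalSpace G] [IsTopologicalGroup G] [T2Space G]
  [LocallyCompactSpace G] [SecondCountableTopology G] [MeasurableSpace G] [BorelSpace G]
  (m : Measure G) [m.IsHaarMeasure] [m.IsMulRightInvariant]

/-- The indicator of a compact set can be replaced by a continuous function with the same integral
whose sums are averages of the number of points in translates of the set. -/
lemma exists_smoothing {K : Set G} (hK : IsCompact K) :
    ∃ (φ : C_c(G, ℝ≥0)) (ψ : G → ℝ≥0∞), Measurable ψ ∧ ∫⁻ x, ψ x ∂m = 1 ∧
      ∫⁻ x, (φ x : ℝ≥0∞) ∂m = m K ∧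
      ∀ A : Set G, A.Countable →
        ∑' p : A, (φ p : ℝ≥0∞) = ∫⁻ y, ψ y * ((A ∩ y • K).encard : ℝ≥0∞) ∂m := by
  obtain ⟨w, hw, -⟩ := exists_isDensity_of_mem_nhds m (U := (univ : Set G)) Filter.univ_mem
  have hwm : Measurable fun x => ENNReal.ofReal (w x) :=
    hw.continuous.measurable.ennreal_ofReal
  have hwq : Continuous fun p : G × G => w (p.1 * p.2⁻¹) :=
    hw.continuous.comp (continuous_fst.mul continuous_snd.inv)
  have hwc : Continuous fun x : G => ∫ z in K, w (x * z⁻¹) ∂m :=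
    continuous_parametric_integral_of_continuous hwq hK
  have hws : HasCompactSupport fun x : G => ∫ z in K, w (x * z⁻¹) ∂m := by
    refine HasCompactSupport.intro (hw.hasCompactSupport.isCompact.mul hK) fun x hx => ?_
    refine setIntegral_eq_zero_of_forall_eq_zero fun z hz => ?_
    by_contra hne
    exact hx ⟨_, subset_tsupport _ hne, z, hz, by simp⟩
  have hval : ∀ x, ((∫ z in K, w (x * z⁻¹) ∂m).toNNReal : ℝ≥0∞) =
      ∫⁻ z, K.indicator 1 z * ENNReal.ofReal (w (x * z⁻¹)) ∂m := by
    intro x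
    change ENNReal.ofReal _ = _
    rw [ofReal_integral_eq_lintegral_ofReal ?_ (ae_of_all _ fun z => hw.nonneg _),
      ← lintegral_indicator hK.measurableSet]
    · congr 1
      ext z
      by_cases hz : z ∈ K <;> simp [hz]
    · exact (hwq.comp (Continuous.prodMk_right x)).continuousOn.integrableOn_compact hK
  have hind : Measurable (K.indicator (1 : G → ℝ≥0∞)) :=
    measurable_one.indicator hK.measurableSet
  have hsmul : ∀ y p : G, (y • K).indicator (1 : G → ℝ≥0∞) p = K.indicator 1 (y⁻¹ * p) := by
    intro y p
    by_cases hy : p ∈ y • K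
    · have h : y⁻¹ * p ∈ K := mem_smul_set_iff_inv_smul_mem.1 hy
      rw [indicator_of_mem hy, indicator_of_mem h]
      rfl
    · have h : y⁻¹ * p ∉ K := fun h => hy (mem_smul_set_iff_inv_smul_mem.2 h)
      rw [indicator_of_notMem hy, indicator_of_notMem h]
  refine ⟨⟨⟨fun x => (∫ z in K, w (x * z⁻¹) ∂m).toNNReal, continuous_real_toNNReal.comp hwc⟩,
    hws.comp_left Real.toNNReal_zero⟩, fun x => ENNReal.ofReal (w x), hwm, ?_, ?_, ?_⟩
  · rw [← ofReal_integral_eq_lintegral_ofReal hw.integrable (ae_of_all _ hw.nonneg),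
      hw.integral_eq_one, ENNReal.ofReal_one]
  · change ∫⁻ x, ((∫ z in K, w (x * z⁻¹) ∂m).toNNReal : ℝ≥0∞) ∂m = m K
    simp only [hval]
    rw [lintegral_lintegral_swap]
    · have : ∀ z, ∫⁻ x, K.indicator 1 z * ENNReal.ofReal (w (x * z⁻¹)) ∂m =
          K.indicator 1 z := by
        intro z
        have hz : Measurable fun x => ENNReal.ofReal (w (x * z⁻¹)) :=
          hwm.comp (measurable_mul_const z⁻¹)
        rw [lintegral_const_mul _ hz,
          lintegral_mul_right_eq_self (fun x => ENNReal.ofReal (w x)) z⁻¹,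
          ← ofReal_integral_eq_lintegral_ofReal hw.integrable (ae_of_all _ hw.nonneg),
          hw.integral_eq_one, ENNReal.ofReal_one, mul_one]
      simp only [this]
      rw [lintegral_indicator_one hK.measurableSet]
    · refine Measurable.aemeasurable ?_
      exact (hind.comp measurable_snd).mul
        (hwm.comp (measurable_fst.mul measurable_snd.inv))
  · intro A hA
    change ∑' p : A, ((∫ z in K, w (p * z⁻¹) ∂m).toNNReal : ℝ≥0∞) = _
    -- The substitution `z = y⁻¹ * p` needs inversion and right invariance of `m`, hence
    -- unimodularity.
    have hsub : ∀ p : G, ∫⁻ z, K.indicator 1 z * ENNReal.ofReal (w (p * z⁻¹)) ∂m =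
        ∫⁻ y, ENNReal.ofReal (w y) * (y • K).indicator 1 p ∂m := by
      intro p
      rw [← lintegral_mul_right_eq_self _ p, ← lintegral_inv_eq_self]
      congr 1
      ext y
      rw [hsmul, mul_comm]
      simp
    have hcount : Countable A := hA.to_subtype
    simp only [hval, hsub]
    rw [← lintegral_tsum]
    · congr 1
      ext y
      rw [ENNReal.tsum_mul_left, tsum_indicator_one]
    · intro p
      refine (hwm.mul ?_).aemeasurable
      simp only [hsmul]
      exact hind.comp (measurable_inv.mul_const _)

variable {m} {Λ : Set G} {μ : Measure (ClosedSubsets G)}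

/-- The Weil formula for the smoothed indicator of `K` expresses `m K` as an integral of sums that
are bounded on the orbit, hence on the hull, by the largest count. -/
lemma measure_le_iSup_encard_mul (hΛ : IsRelativelySeparated Λ)
    (hμ : IsNormalizedHullMeasure m Λ μ) {K : Set G} (hK : IsCompact K) :
    m K ≤ (⨆ x : G, ((Λ ∩ x • K).encard : ℝ≥0∞)) * μ univ := by
  obtain ⟨φ, ψ, hψ, hψ1, hφ, hsum⟩ := exists_smoothing m hK
  rw [← hφ, ← hμ.weil φ, ← lintegral_const]
  refine lintegral_mono_ae ?_
  filter_upwards [ae_mem_hull hμ] with P hP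
  refine tsum_le_of_mem_hull (φ := fun p => (φ p : ℝ≥0∞))
    (ENNReal.continuous_coe.comp φ.continuous) (fun x => ?_) hP
  rw [hsum (x • Λ) (hΛ.countable.image _)]
  calc ∫⁻ y, ψ y * ((x • Λ ∩ y • K).encard : ℝ≥0∞) ∂m
      ≤ ∫⁻ y, ψ y * (⨆ x : G, ((Λ ∩ x • K).encard : ℝ≥0∞)) ∂m := by
        gcongr with y
        rw [encard_smul_inter_smul]
        exact le_iSup (fun x : G => ((Λ ∩ x • K).encard : ℝ≥0∞)) _
    _ = _ := by rw [lintegral_mul_const _ hψ, hψ1, one_mul]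

/-- The same computation from below; merging of points in the hull costs `rel Λ`. -/
lemma iInf_encard_mul_le_rel_mul_measure (hΛ : IsRelativelySeparated Λ)
    (hμ : IsNormalizedHullMeasure m Λ μ) {K : Set G} (hK : IsCompact K) :
    (⨅ x : G, ((Λ ∩ x • K).encard : ℝ≥0∞)) * μ univ ≤ ((rel Λ : ℕ∞) : ℝ≥0∞) * m K := by
  obtain ⟨φ, ψ, hψ, hψ1, hφ, hsum⟩ := exists_smoothing m hK
  rw [← hφ, ← hμ.weil φ, ← lintegral_const,
    ← lintegral_const_mul' _ _ (by simpa using hΛ.ne)]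
  refine lintegral_mono_ae ?_
  filter_upwards [ae_mem_hull hμ] with P hP
  refine le_rel_mul_tsum_of_mem_hull hΛ φ.continuous φ.hasCompactSupport (fun x => ?_) hP
  refine le_trans ?_ (hsum (x • Λ) (hΛ.countable.image _)).ge
  calc ⨅ x : G, ((Λ ∩ x • K).encard : ℝ≥0∞)
      = ∫⁻ y, ψ y * (⨅ x : G, ((Λ ∩ x • K).encard : ℝ≥0∞)) ∂m := by
        rw [lintegral_mul_const _ hψ, hψ1, one_mul]
    _ ≤ ∫⁻ y, ψ y * ((x • Λ ∩ y • K).encard : ℝ≥0∞) ∂m := by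
        gcongr with y
        rw [encard_smul_inter_smul]
        exact iInf_le (fun x : G => ((Λ ∩ x • K).encard : ℝ≥0∞)) _

/-- The mass of a normalized hull measure is at least the inverse of the upper density. -/
lemma inv_measure_le_upperBeurlingDensity (hΛ : IsRelativelySeparated Λ)
    (hμ : IsNormalizedHullMeasure m Λ μ) : (μ univ)⁻¹ ≤ upperBeurlingDensity m Λ := by
  have := hμ.finite
  refine le_iInf₂ fun K hK => ?_
  have h := measure_le_iSup_encard_mul hΛ hμ hK.1
  rw [← ENNReal.iSup_div, ENNReal.le_div_iff_mul_le (Or.inl hK.2.ne')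
    (Or.inl hK.1.measure_lt_top.ne), mul_comm, ← div_eq_mul_inv]
  exact ENNReal.div_le_of_le_mul h

/-- The mass of a normalized hull measure is at most `rel Λ` times the inverse of the lower
density. -/
lemma lowerBeurlingDensity_mul_measure_le (hΛ : IsRelativelySeparated Λ)
    (hμ : IsNormalizedHullMeasure m Λ μ) :
    lowerBeurlingDensity m Λ * μ univ ≤ ((rel Λ : ℕ∞) : ℝ≥0∞) := by
  simp only [lowerBeurlingDensity, ENNReal.iSup_mul]
  refine iSup₂_le fun K hK => ?_
  have h := iInf_encard_mul_le_rel_mul_measure hΛ hμ hK.1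
  calc (⨅ x : G, ((Λ ∩ x • K).encard : ℝ≥0∞) / m K) * μ univ
      = (⨅ x : G, ((Λ ∩ x • K).encard : ℝ≥0∞)) * μ univ / m K := by
        rw [← ENNReal.iInf_div fun h => absurd h hK.2.ne', ENNReal.div_eq_inv_mul, ENNReal.div_eq_inv_mul,
          mul_assoc]
    _ ≤ _ := ENNReal.div_le_of_le_mul h

end MassBounds

/-! ### Limits of orbit averages -/

/-- Lower semicontinuous bounded functions and weak convergence of probability measures. -/
lemma lintegral_le_liminf_of_lowerSemicontinuous {Ω : Type*} [TopologicalSpace Ω]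
    [MeasurableSpace Ω] [BorelSpace Ω] [HasOuterApproxClosed Ω] {ν : ProbabilityMeasure Ω}
    {νs : ℕ → ProbabilityMeasure Ω} (hlim : Filter.Tendsto νs Filter.atTop (𝓝 ν))
    {f : Ω → ℝ≥0∞} (hf : LowerSemicontinuous f) {B : ℝ≥0∞} (hB : B ≠ ∞) (hfB : ∀ x, f x ≤ B) :
    ∫⁻ x, f x ∂(ν : Measure Ω) ≤
      Filter.liminf (fun n => ∫⁻ x, f x ∂(νs n : Measure Ω)) Filter.atTop := by
  have hne : ∀ x, f x ≠ ∞ := fun x => ((hfB x).trans_lt hB.lt_top).ne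
  -- The strict superlevel sets are open: the portmanteau inequality applies to each of them, and
  -- Fatou's lemma integrates over the levels.
  have hcake : ∀ μ : Measure Ω, ∫⁻ x, f x ∂μ = ∫⁻ t in Ioi (0 : ℝ), μ {x | t < (f x).toReal} := by
    intro μ
    rw [← lintegral_eq_lintegral_meas_lt μ (ae_of_all _ fun x => ENNReal.toReal_nonneg)
      hf.measurable.ennreal_toReal.aemeasurable]
    simp only [ENNReal.ofReal_toReal (hne _)]
  have hopen : ∀ t ∈ Ioi (0 : ℝ), IsOpen {x | t < (f x).toReal} := by
    intro t ht
    have : {x | t < (f x).toReal} = f ⁻¹' Ioi (ENNReal.ofReal t) := by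
      ext x
      exact (ENNReal.ofReal_lt_iff_lt_toReal (le_of_lt ht) (hne x)).symm
    rw [this]
    exact hf.isOpen_preimage _
  simp only [hcake]
  refine le_trans (setLIntegral_mono' measurableSet_Ioi fun t ht =>
    ProbabilityMeasure.le_liminf_measure_open_of_tendsto hlim (hopen t ht)) ?_
  exact lintegral_liminf_le fun n => Antitone.measurable fun s t hst =>
    measure_mono fun x hx => lt_of_le_of_lt hst hx

section OrbitAverage

variable {G : Type*} [Group G] [TopologicalSpace G] [IsTopologicalGroup G] [T2Space G]
  [LocallyCompactSpace G] [SecondCountableTopology G] [MeasurableSpace G] [BorelSpace G]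
  (m : Measure G)

/-- The average over `x ∈ K` of the point masses at `x⁻¹ • C`. -/
noncomputable def orbitAverage (C : ClosedSubsets G) (K : Set G) : Measure (ClosedSubsets G) :=
  (m K)⁻¹ • (m.restrict K).map fun x => x⁻¹ • C

lemma continuous_inv_smul_closedSubsets (C : ClosedSubsets G) :
    Continuous fun x : G => x⁻¹ • C :=
  (continuous_smul_closedSubsets C).comp continuous_inv

variable {m}

lemma lintegral_orbitAverage (C : ClosedSubsets G) (K : Set G) {f : ClosedSubsets G → ℝ≥0∞}
    (hf : Measurable f) :
    ∫⁻ P, f P ∂(orbitAverage m C K) = (m K)⁻¹ * ∫⁻ x in K, f (x⁻¹ • C) ∂m := by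
  rw [orbitAverage, lintegral_smul_measure,
    lintegral_map hf (continuous_inv_smul_closedSubsets C).measurable, smul_eq_mul]

variable [m.IsHaarMeasure]

lemma isProbabilityMeasure_orbitAverage (C : ClosedSubsets G) {K : Set G} (hK : IsCompact K)
    (hK0 : 0 < m K) : IsProbabilityMeasure (orbitAverage m C K) := by
  refine ⟨?_⟩
  rw [orbitAverage, Measure.smul_apply, Measure.map_apply
    (continuous_inv_smul_closedSubsets C).measurable MeasurableSet.univ, preimage_univ,
    Measure.restrict_apply_univ, smul_eq_mul,
    ENNReal.inv_mul_cancel hK0.ne' hK.measure_lt_top.ne]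

variable [m.IsMulRightInvariant]

/-- Since `q * x⁻¹ = (x * q⁻¹)⁻¹`, shifting by `q` moves the averaging set from `K` to `K * {q⁻¹}`.
This is why Følner sets for right multiplication are needed. -/
lemma lintegral_smul_orbitAverage_le (C : ClosedSubsets G) {K : Set G} (hK : IsCompact K) (q : G)
    (f : ClosedSubsets G →ᵇ ℝ≥0) {b : ℝ≥0} (hb : ∀ P, f P ≤ b) :
    ∫⁻ P, f (q • P) ∂(orbitAverage m C K) ≤ ∫⁻ P, f P ∂(orbitAverage m C K) +
      b * (m ((K * {q⁻¹}) \ K) / m K) := by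
  have hfm : Measurable fun P => (f P : ℝ≥0∞) := f.continuous.measurable.coe_nnreal_ennreal
  have hKq : MeasurableSet (K * {q⁻¹}) := (hK.mul isCompact_singleton).measurableSet
  rw [lintegral_orbitAverage C K hfm, lintegral_orbitAverage C K
    (f := fun P => (f (q • P) : ℝ≥0∞)) (hfm.comp (continuous_const_smul q).measurable),
    mul_comm (b : ℝ≥0∞), ENNReal.div_eq_inv_mul, mul_assoc, ← mul_add]
  gcongr
  have h1 : ∫⁻ x in K, (f (q • x⁻¹ • C) : ℝ≥0∞) ∂m =
      ∫⁻ x in K * {q⁻¹}, (f (x⁻¹ • C) : ℝ≥0∞) ∂m := by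
    rw [← lintegral_indicator hK.measurableSet, ← lintegral_indicator hKq,
      ← lintegral_mul_right_eq_self (fun x => (K * {q⁻¹}).indicator _ x) q⁻¹]
    congr 1
    ext x
    by_cases hx : x ∈ K
    · rw [indicator_of_mem hx, indicator_of_mem (mul_mem_mul hx (mem_singleton q⁻¹)), mul_inv_rev, inv_inv,
        mul_smul]
    · rw [indicator_of_notMem hx, indicator_of_notMem]
      rintro ⟨y, hy, _, rfl, hyx⟩
      exact hx (mul_right_cancel hyx ▸ hy)
  rw [h1]
  calc ∫⁻ x in K * {q⁻¹}, (f (x⁻¹ • C) : ℝ≥0∞) ∂m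
      ≤ ∫⁻ x in K ∪ (K * {q⁻¹}) \ K, (f (x⁻¹ • C) : ℝ≥0∞) ∂m :=
        lintegral_mono_set (by rw [union_sdiff_self]; exact subset_union_right)
    _ ≤ ∫⁻ x in K, (f (x⁻¹ • C) : ℝ≥0∞) ∂m +
        ∫⁻ x in (K * {q⁻¹}) \ K, (f (x⁻¹ • C) : ℝ≥0∞) ∂m := lintegral_union_le _ _ _
    _ ≤ _ := by
        gcongr
        rw [mul_comm, ← setLIntegral_const]
        exact lintegral_mono fun x => ENNReal.coe_le_coe.2 (hb _)

/-- Along a Følner sequence, the orbit averages accumulate at an invariant probability measure on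
the hull. -/
lemma exists_invariant_limit {Λ : Set G} {C : ClosedSubsets G} (hC : C.carrier = Λ)
    {K : ℕ → Set G} (hK : ∀ n, IsCompact (K n)) (hK0 : ∀ n, 0 < m (K n))
    (hinv : ∀ q : G, Filter.Tendsto (fun n => m ((K n * {q}) \ K n) / m (K n))
      Filter.atTop (𝓝 0)) :
    ∃ ν : Measure (ClosedSubsets G), IsProbabilityMeasure ν ∧
      SMulInvariantMeasure G (ClosedSubsets G) ν ∧ (∀ᵐ P ∂ν, P ∈ hull Λ) ∧
      ∃ s : ℕ → ℕ, StrictMono s ∧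
        (∀ f : ClosedSubsets G → ℝ≥0, Continuous f →
          Filter.Tendsto (fun n => ∫⁻ P, f P ∂(orbitAverage m C (K (s n)))) Filter.atTop
            (𝓝 (∫⁻ P, f P ∂ν))) ∧
        ∀ f : ClosedSubsets G → ℝ≥0∞, LowerSemicontinuous f → ∀ B : ℝ≥0∞, B ≠ ∞ →
          (∀ P ∈ hull Λ, f P ≤ B) →
          ∫⁻ P, f P ∂ν ≤
            Filter.liminf (fun n => ∫⁻ P, f P ∂(orbitAverage m C (K (s n)))) Filter.atTop := by
  let νs : ℕ → ProbabilityMeasure (ClosedSubsets G) := fun n =>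
    ⟨orbitAverage m C (K n), isProbabilityMeasure_orbitAverage C (hK n) (hK0 n)⟩
  obtain ⟨ν, -, s, hs, hlim⟩ :=
    (isCompact_univ (X := ProbabilityMeasure (ClosedSubsets G))).isSeqCompact (x := νs)
      fun n => mem_univ _
  have hcont := ProbabilityMeasure.tendsto_iff_forall_lintegral_tendsto.1 hlim
  have horb : ∀ n, (νs n : Measure (ClosedSubsets G)) (hull Λ)ᶜ = 0 := by
    intro n
    change orbitAverage m C (K n) (hull Λ)ᶜ = 0
    rw [← lintegral_indicator_one isClosed_hull.measurableSet.compl, lintegral_orbitAverage C _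
      (measurable_one.indicator isClosed_hull.measurableSet.compl)]
    have : ∀ x : G, (hull Λ)ᶜ.indicator (1 : ClosedSubsets G → ℝ≥0∞) (x⁻¹ • C) = 0 := fun x =>
      indicator_of_notMem (not_not.2 (subset_closure
        (show x⁻¹ • C ∈ {C | ∃ x : G, C.carrier = x • Λ} from ⟨x⁻¹, by rw [carrier_smul, hC]⟩))) _
    simp [this]
  -- One inequality suffices: applied to `q⁻¹` and the translated function, it yields the reverse.
  have hle : ∀ (q : G) (f : ClosedSubsets G →ᵇ ℝ≥0),
      ∫⁻ P, f (q • P) ∂(ν : Measure (ClosedSubsets G)) ≤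
      ∫⁻ P, f P ∂(ν : Measure (ClosedSubsets G)) := by
    intro q f
    obtain ⟨b, hb⟩ := (isCompact_range f.continuous).bddAbove
    have h1 := hcont (f.compContinuous ⟨fun P => q • P, continuous_const_smul q⟩)
    have h2 : Filter.Tendsto (fun n => ∫⁻ P, f P ∂(νs (s n) : Measure (ClosedSubsets G)) +
        b * (m ((K (s n) * {q⁻¹}) \ K (s n)) / m (K (s n)))) Filter.atTop
        (𝓝 (∫⁻ P, f P ∂(ν : Measure (ClosedSubsets G)) + b * 0)) :=
      (hcont f).add (ENNReal.Tendsto.const_mul ((hinv q⁻¹).comp hs.tendsto_atTop)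
        (Or.inr ENNReal.coe_ne_top))
    rw [mul_zero, add_zero] at h2
    exact le_of_tendsto_of_tendsto' h1 h2 fun n =>
      lintegral_smul_orbitAverage_le C (hK (s n)) q f fun P => hb ⟨P, rfl⟩
  have hmap : ∀ q : G, (ν : Measure (ClosedSubsets G)).map (fun P => q • P) = ν := by
    intro q
    have := Measure.isProbabilityMeasure_map (μ := (ν : Measure (ClosedSubsets G)))
      (continuous_const_smul q : Continuous fun P : ClosedSubsets G => q • P).aemeasurable
    refine ext_of_forall_lintegral_eq_of_IsFiniteMeasure fun f => ?_
    rw [lintegral_map f.continuous.measurable.coe_nnreal_ennreal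
      (continuous_const_smul q).measurable]
    refine le_antisymm (hle q f) ?_
    have := hle q⁻¹ (f.compContinuous ⟨fun P => q • P, continuous_const_smul q⟩)
    simpa using this
  have hhull : ∀ᵐ P ∂(ν : Measure (ClosedSubsets G)), P ∈ hull Λ := by
    have := ProbabilityMeasure.le_liminf_measure_open_of_tendsto hlim
      (isClosed_hull (Λ := Λ)).isOpen_compl
    simp only [Function.comp_apply, horb, Filter.liminf_const] at this
    exact le_antisymm this bot_le
  refine ⟨ν, inferInstance, ⟨fun q S hS => ?_⟩, hhull, s, hs, fun f hf => ?_,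
    fun f hf B hB hfB => ?_⟩
  · rw [← Measure.map_apply (continuous_const_smul q).measurable hS, hmap]
  · exact hcont (BoundedContinuousFunction.mkOfCompact ⟨f, hf⟩)
  -- The bound on `f` holds only on the hull; truncating at `B` makes it global without changing the
  -- integral against `ν`.
  · have h1 : ∫⁻ P, f P ∂(ν : Measure (ClosedSubsets G)) =
        ∫⁻ P, min (f P) B ∂(ν : Measure (ClosedSubsets G)) := by
      refine lintegral_congr_ae ?_
      filter_upwards [hhull] with P hP
      rw [min_eq_left (hfB P hP)]
    have hmin : LowerSemicontinuous fun P => min (f P) B :=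
      hf.inf lowerSemicontinuous_const
    rw [h1]
    refine (lintegral_le_liminf_of_lowerSemicontinuous hlim hmin hB
      fun P => min_le_right _ _).trans (Filter.liminf_le_liminf (Filter.Eventually.of_forall
        fun n => lintegral_mono fun P => min_le_left _ _))

end OrbitAverage

/-! ### The intensity of an invariant measure -/

section Intensity

variable {G : Type*} [Group G] [TopologicalSpace G] [IsTopologicalGroup G] [T2Space G]
  [LocallyCompactSpace G] [SecondCountableTopology G] [MeasurableSpace G] [BorelSpace G]
  (m : Measure G) [m.IsHaarMeasure] {Λ : Set G}

/-- Counts in translates of the support are uniformly bounded, and semicontinuity carries the bound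
to the hull. -/
lemma IsRelativelySeparated.exists_tsum_le (hΛ : IsRelativelySeparated Λ) (φ : C_c(G, ℝ≥0)) :
    ∃ B : ℝ≥0∞, B ≠ ∞ ∧ ∀ P ∈ hull Λ, ∑' p : P.carrier, (φ p : ℝ≥0∞) ≤ B := by
  obtain ⟨N, hN⟩ := hΛ.exists_encard_le φ.hasCompactSupport.isCompact
  obtain ⟨c, hc⟩ : ∃ c : ℝ≥0, ∀ p, φ p ≤ c := by
    obtain ⟨c, hc⟩ := (φ.hasCompactSupport.isCompact_range φ.continuous).bddAbove
    exact ⟨c, fun p => hc ⟨p, rfl⟩⟩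
  refine ⟨N * c, ENNReal.mul_ne_top (by simp) (by simp), fun P hP => ?_⟩
  refine tsum_le_of_mem_hull (φ := fun p => (φ p : ℝ≥0∞))
    (ENNReal.continuous_coe.comp φ.continuous) (fun x => ?_) hP
  refine (tsum_le_encard_mul (K := tsupport φ) (c := c) (fun p hp => ?_)
    (fun p _ => ENNReal.coe_le_coe.2 (hc p))).trans ?_
  · rw [image_eq_zero_of_notMem_tsupport hp, ENNReal.coe_zero]
  · gcongr
    have := (encard_smul_inter_smul Λ (tsupport φ) x 1).trans_le (hN _)
    rw [one_smul] at this
    have h2 : (((x • Λ ∩ tsupport φ).encard : ℕ∞) : ℝ≥0∞) ≤ ((N : ℕ∞) : ℝ≥0∞) := by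
      exact_mod_cast this
    simpa using h2

lemma measurable_tsum (φ : C_c(G, ℝ≥0)) :
    Measurable fun P : ClosedSubsets G => ∑' p : P.carrier, (φ p : ℝ≥0∞) :=
  (lowerSemicontinuous_tsum (φ := fun p => (φ p : ℝ≥0∞))
    (ENNReal.continuous_coe.comp φ.continuous)).measurable

/-- A finite invariant measure on the hull satisfies the Weil formula up to a constant. -/
lemma exists_intensity (hΛ : IsRelativelySeparated Λ) (ν : Measure (ClosedSubsets G))
    [IsFiniteMeasure ν] [SMulInvariantMeasure G (ClosedSubsets G) ν]
    (hν : ∀ᵐ P ∂ν, P ∈ hull Λ) :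
    ∃ c : ℝ≥0, ∀ φ : C_c(G, ℝ≥0),
      ∫⁻ P, ∑' p : P.carrier, (φ p : ℝ≥0∞) ∂ν = c * ∫⁻ x, (φ x : ℝ≥0∞) ∂m := by
  have hfin : ∀ φ : C_c(G, ℝ≥0), ∫⁻ P, ∑' p : P.carrier, (φ p : ℝ≥0∞) ∂ν ≠ ∞ := by
    intro φ
    obtain ⟨B, hB, hle⟩ := hΛ.exists_tsum_le φ
    refine ((lintegral_mono_ae (hν.mono fun P hP => hle P hP)).trans_lt ?_).ne
    rw [lintegral_const]
    exact ENNReal.mul_lt_top hB.lt_top (measure_lt_top _ _)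
  -- Invariance of `ν` makes the Riesz measure of `J` left invariant, so it is a multiple of `m`;
  -- the factor is `c`.
  let J : C_c(G, ℝ≥0) →ₗ[ℝ≥0] ℝ≥0 :=
    { toFun := fun φ => (∫⁻ P, ∑' p : P.carrier, (φ p : ℝ≥0∞) ∂ν).toNNReal
      map_add' := fun φ φ' => by
        rw [← ENNReal.toNNReal_add (hfin φ) (hfin φ'), ← lintegral_add_left (measurable_tsum φ)]
        congr 2
        ext P
        rw [← ENNReal.tsum_add]
        simp
      map_smul' := fun a φ => by
        rw [RingHom.id_apply, smul_eq_mul, ← ENNReal.toNNReal_coe a, ← ENNReal.toNNReal_mul,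
          ← lintegral_const_mul _ (measurable_tsum φ)]
        congr 2
        ext P
        rw [← ENNReal.tsum_mul_left]
        simp }
  have hJ : ∀ φ : C_c(G, ℝ≥0), ∫⁻ x, (φ x : ℝ≥0∞) ∂(NNRealRMK.rieszMeasure J) =
      ∫⁻ P, ∑' p : P.carrier, (φ p : ℝ≥0∞) ∂ν := fun φ => by
    rw [NNRealRMK.lintegral_rieszMeasure]
    exact ENNReal.coe_toNNReal (hfin φ)
  have hinv : (NNRealRMK.rieszMeasure J).IsMulLeftInvariant := by
    refine ⟨fun g => ?_⟩
    have : (Measure.map (fun x => g * x) (NNRealRMK.rieszMeasure J)).Regular :=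
      Measure.Regular.map (Homeomorph.mulLeft g)
    refine Measure.ext_of_integral_eq_on_compactlySupported_nnreal fun φ => ?_
    rw [integral_map (continuous_const_mul g).measurable.aemeasurable
      (Continuous.aestronglyMeasurable (by fun_prop))]
    let φg : C_c(G, ℝ≥0) := ⟨⟨fun x => φ (g * x), by fun_prop⟩,
      φ.hasCompactSupport.comp_homeomorph (Homeomorph.mulLeft g)⟩
    change ∫ x, ((φg x : ℝ≥0) : ℝ) ∂_ = _
    rw [NNRealRMK.integral_rieszMeasure, NNRealRMK.integral_rieszMeasure]
    congr 1
    change (∫⁻ P, ∑' p : P.carrier, (φ (g * p) : ℝ≥0∞) ∂ν).toNNReal =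
      (∫⁻ P, ∑' p : P.carrier, (φ p : ℝ≥0∞) ∂ν).toNNReal
    congr 1
    have hg : MeasurePreserving (fun P : ClosedSubsets G => g • P) ν ν :=
      measurePreserving_smul g ν
    rw [← hg.lintegral_comp (measurable_tsum φ)]
    congr 1
    ext P
    exact (tsum_smul_set (fun p => (φ p : ℝ≥0∞)) g P.carrier).symm
  refine ⟨Measure.haarScalarFactor (NNRealRMK.rieszMeasure J) m, fun φ => ?_⟩
  rw [← hJ]
  conv_lhs => rw [Measure.isMulLeftInvariant_eq_smul (NNRealRMK.rieszMeasure J) m]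
  rw [lintegral_smul_measure]
  rfl

/-- Normalizing a finite invariant measure on the hull. -/
lemma isNormalizedHullMeasure_smul_restrict {ν : Measure (ClosedSubsets G)}
    [IsFiniteMeasure ν] [SMulInvariantMeasure G (ClosedSubsets G) ν]
    (hν : ∀ᵐ P ∂ν, P ∈ hull Λ) {c : ℝ≥0} (hc : c ≠ 0)
    (hweil : ∀ φ : C_c(G, ℝ≥0),
      ∫⁻ P, ∑' p : P.carrier, (φ p : ℝ≥0∞) ∂ν = c * ∫⁻ x, (φ x : ℝ≥0∞) ∂m) :
    IsNormalizedHullMeasure m Λ (c⁻¹ • ν.restrict {P | P.carrier = ∅}ᶜ) := by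
  have hms : MeasurableSet {P : ClosedSubsets G | P.carrier = ∅} :=
    isClosed_setOf_carrier_eq_empty.measurableSet
  refine ⟨inferInstance, ?_, ⟨fun g S hS => ?_⟩, fun φ => ?_⟩
  · rw [Measure.smul_apply, smul_eq_zero]
    right
    change ∀ᵐ P ∂(ν.restrict {P | P.carrier = ∅}ᶜ), P ∈ puncturedHull Λ
    filter_upwards [ae_restrict_of_ae hν, ae_restrict_mem hms.compl] with P h1 h2
    exact ⟨h1, h2⟩
  · rw [Measure.smul_apply, Measure.smul_apply, Measure.restrict_apply hS,
      Measure.restrict_apply ((continuous_const_smul g).measurable hS)]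
    congr 1
    rw [← SMulInvariantMeasure.measure_preimage_smul (μ := ν) g (hS.inter hms.compl)]
    congr 1
    ext P
    simp
  · rw [lintegral_smul_measure, ← lintegral_indicator hms.compl]
    -- The empty set has zero sum, so discarding it leaves the Weil formula intact.
    have : ∀ P : ClosedSubsets G, {P : ClosedSubsets G | P.carrier = ∅}ᶜ.indicator
        (fun P : ClosedSubsets G => ∑' p : P.carrier, (φ p : ℝ≥0∞)) P =
        ∑' p : P.carrier, (φ p : ℝ≥0∞) := by
      intro P
      by_cases hP : P.carrier = ∅
      · rw [indicator_of_notMem (not_not.2 hP), hP, tsum_empty]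
      · exact indicator_of_mem hP _
    simp only [this]
    rw [hweil, ENNReal.smul_def, smul_eq_mul, ← mul_assoc, ENNReal.coe_inv hc,
      ENNReal.inv_mul_cancel (by simpa using hc) ENNReal.coe_ne_top, one_mul]

end Intensity

/-! ### Existence of hull measures with controlled mass -/

section Existence

variable {G : Type*} [Group G] [TopologicalSpace G] [IsTopologicalGroup G] [T2Space G]
  [LocallyCompactSpace G] [SecondCountableTopology G] [MeasurableSpace G] [BorelSpace G]
  {m : Measure G} [m.IsHaarMeasure] [m.IsMulRightInvariant] {Λ : Set G}

lemma lintegral_tsum_orbitAverage {C : ClosedSubsets G} (hC : C.carrier = Λ) (hΛ : Λ.Countable)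
    (φ : C_c(G, ℝ≥0)) (K : Set G) :
    ∫⁻ P, ∑' p : P.carrier, (φ p : ℝ≥0∞) ∂(orbitAverage m C K) =
      (m K)⁻¹ * ∑' p : Λ, ∫⁻ x in K, (φ (x⁻¹ * p) : ℝ≥0∞) ∂m := by
  have : Countable Λ := hΛ.to_subtype
  rw [lintegral_orbitAverage C K (measurable_tsum φ), ← lintegral_tsum]
  · congr 2
    ext x
    rw [carrier_smul, hC]
    exact tsum_smul_set (fun p => (φ p : ℝ≥0∞)) x⁻¹ Λ
  · intro p
    exact Continuous.aemeasurable (by fun_prop)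

lemma lintegral_inv_mul_eq (φ : C_c(G, ℝ≥0)) (p : G) :
    ∫⁻ x, (φ (x⁻¹ * p) : ℝ≥0∞) ∂m = ∫⁻ x, (φ x : ℝ≥0∞) ∂m := by
  rw [lintegral_inv_eq_self (μ := m) (fun x => (φ (x * p) : ℝ≥0∞)),
    lintegral_mul_right_eq_self (fun x => (φ x : ℝ≥0∞)) p]

/-- The factor `S` absorbs boundary effects from the support of a test function; the exhaustion `E
n` gives asymptotic invariance under each fixed element, which eventually lies in `E n`. -/
lemma exists_folner_sequence (hG : IsAmenable G) {S : Set G} (hS : IsCompact S)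
    (E : CompactExhaustion G) :
    ∃ K : ℕ → Set G, ∀ n, IsCompact (K n) ∧ 0 < m (K n) ∧
      m (K n * (S * ({1} ∪ E n))) ≤ ENNReal.ofReal (1 + 1 / ((n : ℝ) + 1)) * m (K n) := by
  choose K hK using fun n : ℕ => exists_isCompact_measure_mul_le' m hG
    (hS.mul (isCompact_singleton.union (E.isCompact n)) : IsCompact (S * ({1} ∪ E n)))
    (Nat.one_div_pos_of_nat (α := ℝ) (n := n))
  exact ⟨K, hK⟩

lemma tendsto_measure_sdiff_div {E : CompactExhaustion G} {K : ℕ → Set G}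
    (hK : ∀ n, IsCompact (K n))
    (h : ∀ n, ∀ q ∈ E n,
      m (K n ∪ K n * {q}) ≤ ENNReal.ofReal (1 + 1 / ((n : ℝ) + 1)) * m (K n)) (q : G) :
    Filter.Tendsto (fun n => m ((K n * {q}) \ K n) / m (K n)) Filter.atTop (𝓝 0) := by
  have h0 : Filter.Tendsto (fun n : ℕ => ENNReal.ofReal (1 / ((n : ℝ) + 1))) Filter.atTop
      (𝓝 0) := by
    rw [← ENNReal.ofReal_zero]
    exact ENNReal.tendsto_ofReal tendsto_one_div_add_atTop_nhds_zero_nat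
  refine tendsto_of_tendsto_of_tendsto_of_le_of_le' tendsto_const_nhds h0
    (Filter.Eventually.of_forall fun _ => bot_le) ?_
  obtain ⟨N, hN⟩ := E.exists_mem q
  filter_upwards [Filter.eventually_ge_atTop N] with n hn
  have h1 := h n q (E.subset hn hN)
  rw [← union_sdiff_self, measure_union disjoint_sdiff_right
    (((hK n).mul isCompact_singleton).measurableSet.diff (hK n).measurableSet),
    ENNReal.ofReal_add zero_le_one (by positivity), ENNReal.ofReal_one, add_mul, one_mul,
    ENNReal.add_le_add_iff_left (hK n).measure_lt_top.ne] at h1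
  exact ENNReal.div_le_of_le_mul h1

lemma tendsto_ofReal_one_add :
    Filter.Tendsto (fun n : ℕ => ENNReal.ofReal (1 + 1 / ((n : ℝ) + 1))) Filter.atTop (𝓝 1) := by
  rw [← ENNReal.ofReal_one]
  refine ENNReal.tendsto_ofReal ?_
  simpa using tendsto_one_div_add_atTop_nhds_zero_nat.const_add (1 : ℝ)

/-- For every number below the upper density there is a normalized hull measure whose mass is
bounded in terms of it. -/
lemma exists_hullMeasure_mul_le_rel (hG : IsAmenable G) (hΛ : IsRelativelySeparated Λ)
    {d : ℝ≥0∞} (hd0 : d ≠ 0) (hd : d < upperBeurlingDensity m Λ) :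
    ∃ μ, IsNormalizedHullMeasure m Λ μ ∧ d * μ univ ≤ ((rel Λ : ℕ∞) : ℝ≥0∞) := by
  have hrel : ((rel Λ : ℕ∞) : ℝ≥0∞) ≠ ∞ := by simpa using hΛ.ne
  let C : ClosedSubsets G := ⟨Λ, hΛ.isClosed⟩
  obtain ⟨U, hU, h1U, hcard⟩ := hΛ.exists_nhds
  -- Support in `U` means that at most `rel Λ` points of any translate of `Λ` contribute, so the sum
  -- of `φ` is at most `rel Λ` times its supremum.
  obtain ⟨w, hw, hwU⟩ := exists_isDensity_of_mem_nhds m (hU.mem_nhds h1U)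
  let φ : C_c(G, ℝ≥0) := ⟨⟨fun x => (w x).toNNReal, continuous_real_toNNReal.comp hw.continuous⟩,
    hw.hasCompactSupport.comp_left Real.toNNReal_zero⟩
  have hφ0 : ∀ x, x ∉ tsupport w → φ x = 0 := fun x hx => by
    change (w x).toNNReal = 0
    rw [image_eq_zero_of_notMem_tsupport hx, Real.toNNReal_zero]
  have hφ1 : ∫⁻ x, (φ x : ℝ≥0∞) ∂m = 1 := by
    change ∫⁻ x, ENNReal.ofReal (w x) ∂m = 1
    rw [← ofReal_integral_eq_lintegral_ofReal hw.integrable (ae_of_all _ hw.nonneg),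
      hw.integral_eq_one, ENNReal.ofReal_one]
  set Q : Set G := tsupport w with hQdef
  have hQ : IsCompact Q := hw.hasCompactSupport.isCompact
  have hQne : Q.Nonempty := by
    by_contra hne
    rw [not_nonempty_iff_eq_empty] at hne
    simp [hφ0, hne] at hφ1
  obtain ⟨E⟩ : Nonempty (CompactExhaustion G) := inferInstance
  obtain ⟨K₀, hK₀⟩ := exists_folner_sequence (m := m) hG hQ.inv E
  have hy : ∀ n, ∃ y : G, d * m (K₀ n) ≤ ((Λ ∩ y • K₀ n).encard : ℝ≥0∞) := by
    intro n
    have h1 := hd.trans_le (iInf₂_le (K₀ n) ⟨(hK₀ n).1, (hK₀ n).2.1⟩)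
    obtain ⟨y, hy⟩ := lt_iSup_iff.1 h1
    exact ⟨y, ((ENNReal.lt_div_iff_mul_lt (Or.inl (hK₀ n).2.1.ne')
      (Or.inl (hK₀ n).1.measure_lt_top.ne)).1 hy).le⟩
  choose y hy using hy
  -- Enlarging by `Q⁻¹` puts the whole mass of `x ↦ φ (x⁻¹ * p)` inside `K n` for every `p ∈ y n •
  -- K₀ n`, so each counted point contributes exactly 1.
  let K : ℕ → Set G := fun n => y n • (K₀ n * Q⁻¹)
  have hK : ∀ n, IsCompact (K n) := fun n => ((hK₀ n).1.mul hQ.inv).smul _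
  have hmK : ∀ n, m (K₀ n) ≤ m (K n) := fun n => by
    obtain ⟨q, hq⟩ := hQne
    rw [measure_smul, ← measure_preimage_mul_right m q (K₀ n)]
    exact measure_mono fun x hx => ⟨x * q, hx, q⁻¹, inv_mem_inv.2 hq, mul_inv_cancel_right x q⟩
  have hK0 : ∀ n, 0 < m (K n) := fun n => (hK₀ n).2.1.trans_le (hmK n)
  have hbound : ∀ n, ∀ T ⊆ y n • (K₀ n * (Q⁻¹ * ({1} ∪ E n))),
      m T ≤ ENNReal.ofReal (1 + 1 / ((n : ℝ) + 1)) * m (K₀ n) := fun n T hT => by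
    refine (measure_mono hT).trans ?_
    rw [measure_smul]
    exact (hK₀ n).2.2
  have hKsub : ∀ n, K n ⊆ y n • (K₀ n * (Q⁻¹ * ({1} ∪ E n))) := fun n =>
    smul_set_mono (mul_subset_mul_left (subset_mul_left _ (Or.inl rfl)))
  obtain ⟨ν, hν, hνinv, hνhull, s, hs, hlim, -⟩ := exists_invariant_limit (C := C) rfl hK hK0
    (tendsto_measure_sdiff_div (E := E) hK fun n q hq => by
      refine (hbound n _ (union_subset (hKsub n) ?_)).trans (mul_le_mul' le_rfl (hmK n))
      rintro _ ⟨_, ⟨x, ⟨k, hk, r, hr, rfl⟩, rfl⟩, q', hq', rfl⟩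
      rw [mem_singleton_iff.1 hq']
      exact ⟨k * (r * q), ⟨k, hk, _, ⟨r, hr, q, Or.inr hq, rfl⟩, rfl⟩, by
        simp [mul_assoc]⟩)
  obtain ⟨c, hc⟩ := exists_intensity m hΛ ν hνhull
  -- A lower bound on `c` must survive the weak limit, which semicontinuity of the sum does not
  -- give; its continuous substitute `Φ` does, at the cost of `rel Λ`.
  let Φ : ClosedSubsets G → ℝ≥0∞ := fun P => ⨆ x ∈ P.carrier, (φ x : ℝ≥0∞)
  have hΦc : Continuous Φ := continuous_biSup (ENNReal.continuous_coe.comp φ.continuous)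
    (φ.hasCompactSupport.comp_left (g := ((↑) : ℝ≥0 → ℝ≥0∞)) rfl)
  have hΦne : ∀ P, Φ P ≠ ∞ := fun P => by
    obtain ⟨b, hb⟩ := (φ.hasCompactSupport.isCompact_range φ.continuous).bddAbove
    exact ((iSup₂_le fun x _ => ENNReal.coe_le_coe.2 (hb ⟨x, rfl⟩)).trans_lt
      (ENNReal.coe_lt_top (r := b))).ne
  have hlimΦ : Filter.Tendsto (fun n => ∫⁻ P, Φ P ∂(orbitAverage m C (K (s n)))) Filter.atTop
      (𝓝 (∫⁻ P, Φ P ∂ν)) := by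
    have := hlim (fun P => (Φ P).toNNReal) (continuous_iff_continuousAt.2 fun P =>
      (ENNReal.tendsto_toNNReal (hΦne P)).comp hΦc.continuousAt)
    simpa only [ENNReal.coe_toNNReal (hΦne _)] using this
  have hlow : ∀ n : ℕ, d ≤ ENNReal.ofReal (1 + 1 / ((n : ℝ) + 1)) *
      (((rel Λ : ℕ∞) : ℝ≥0∞) * ∫⁻ P, Φ P ∂(orbitAverage m C (K n))) := by
    intro n
    have h1 : ∫⁻ P, ∑' p : P.carrier, (φ p : ℝ≥0∞) ∂(orbitAverage m C (K n)) ≤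
        ((rel Λ : ℕ∞) : ℝ≥0∞) * ∫⁻ P, Φ P ∂(orbitAverage m C (K n)) := by
      rw [← lintegral_const_mul _ hΦc.measurable,
        lintegral_orbitAverage C _ (measurable_tsum φ),
        lintegral_orbitAverage C _ (hΦc.measurable.const_mul _)]
      gcongr with x
      refine (tsum_le_encard_mul (K := U) (c := Φ (x⁻¹ • C)) (fun p hp => ?_)
        (fun p hp => le_iSup₂ (f := fun y (_ : y ∈ (x⁻¹ • C).carrier) => (φ y : ℝ≥0∞))
          p hp)).trans ?_
      · rw [hφ0 p fun h => hp (hwU h), ENNReal.coe_zero]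
      · gcongr
        have := encard_smul_inter_smul Λ U x⁻¹ 1
        rw [one_smul] at this
        exact this.trans_le (hcard _)
    have h2 : (m (K n))⁻¹ * ((Λ ∩ y n • K₀ n).encard : ℝ≥0∞) ≤
        ∫⁻ P, ∑' p : P.carrier, (φ p : ℝ≥0∞) ∂(orbitAverage m C (K n)) := by
      rw [lintegral_tsum_orbitAverage (C := C) rfl hΛ.countable, ← tsum_indicator_one]
      gcongr with p
      by_cases hp : (p : G) ∈ y n • K₀ n
      · rw [indicator_of_mem hp, Pi.one_apply, ← hφ1, ← lintegral_inv_mul_eq φ p,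
          ← lintegral_indicator (hK n).measurableSet]
        refine lintegral_mono fun x => ?_
        by_cases hx : x ∈ K n
        · rw [indicator_of_mem hx]
        · rw [hφ0, ENNReal.coe_zero]
          · exact bot_le
          · intro hxp
            obtain ⟨k, hk, hkp⟩ := hp
            refine hx ⟨k * (x⁻¹ * p)⁻¹, mul_mem_mul hk (inv_mem_inv.2 hxp), ?_⟩
            simp only [smul_eq_mul] at hkp ⊢
            rw [← mul_assoc, hkp]
            simp
      · rw [indicator_of_notMem hp]
        exact bot_le
    have h3 : m (K n) ≤ ENNReal.ofReal (1 + 1 / ((n : ℝ) + 1)) * m (K₀ n) :=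
      hbound n _ (hKsub n)
    have h4 : d * m (K n) ≤ ENNReal.ofReal (1 + 1 / ((n : ℝ) + 1)) *
        ((Λ ∩ y n • K₀ n).encard : ℝ≥0∞) := by
      calc d * m (K n) ≤ d * (ENNReal.ofReal (1 + 1 / ((n : ℝ) + 1)) * m (K₀ n)) := by gcongr
        _ = ENNReal.ofReal (1 + 1 / ((n : ℝ) + 1)) * (d * m (K₀ n)) := by ring
        _ ≤ _ := by gcongr; exact hy n
    calc d ≤ ENNReal.ofReal (1 + 1 / ((n : ℝ) + 1)) *
          ((Λ ∩ y n • K₀ n).encard : ℝ≥0∞) / m (K n) :=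
          (ENNReal.le_div_iff_mul_le (Or.inl (hK0 n).ne')
            (Or.inl (hK n).measure_lt_top.ne)).2 h4
      _ = ENNReal.ofReal (1 + 1 / ((n : ℝ) + 1)) *
          ((m (K n))⁻¹ * ((Λ ∩ y n • K₀ n).encard : ℝ≥0∞)) := by
          rw [div_eq_mul_inv, mul_assoc, mul_comm (m (K n))⁻¹]
      _ ≤ _ := mul_le_mul' le_rfl (h2.trans h1)
  have hdc : d ≤ ((rel Λ : ℕ∞) : ℝ≥0∞) * c := by
    have h1 : Filter.Tendsto (fun n => ENNReal.ofReal (1 + 1 / ((s n : ℝ) + 1)) *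
        (((rel Λ : ℕ∞) : ℝ≥0∞) * ∫⁻ P, Φ P ∂(orbitAverage m C (K (s n))))) Filter.atTop
        (𝓝 (1 * (((rel Λ : ℕ∞) : ℝ≥0∞) * ∫⁻ P, Φ P ∂ν))) :=
      ENNReal.Tendsto.mul (tendsto_ofReal_one_add.comp hs.tendsto_atTop)
        (Or.inl one_ne_zero) (ENNReal.Tendsto.const_mul hlimΦ (Or.inr hrel))
        (Or.inr ENNReal.one_ne_top)
    refine (ge_of_tendsto' h1 fun n => hlow (s n)).trans ?_
    rw [one_mul]
    gcongr
    calc ∫⁻ P, Φ P ∂ν ≤ ∫⁻ P, ∑' p : P.carrier, (φ p : ℝ≥0∞) ∂ν :=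
          lintegral_mono fun P => iSup₂_le fun x hx =>
            ENNReal.le_tsum (f := fun p : P.carrier => (φ p : ℝ≥0∞)) ⟨x, hx⟩
      _ = c := by rw [hc, hφ1, mul_one]
  have hc0 : c ≠ 0 := by
    rintro rfl
    simp only [ENNReal.coe_zero, mul_zero, nonpos_iff_eq_zero] at hdc
    exact hd0 hdc
  refine ⟨_, isNormalizedHullMeasure_smul_restrict m hνhull hc0 hc, ?_⟩
  rw [Measure.smul_apply, ENNReal.smul_def, smul_eq_mul, ENNReal.coe_inv hc0,
    Measure.restrict_apply_univ]
  calc d * ((c : ℝ≥0∞)⁻¹ * ν {P | P.carrier = ∅}ᶜ)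
      ≤ (((rel Λ : ℕ∞) : ℝ≥0∞) * c) * ((c : ℝ≥0∞)⁻¹ * 1) := by
        gcongr
        exact prob_le_one
    _ = _ := by
        rw [mul_one, mul_assoc, ENNReal.mul_inv_cancel (by simpa using hc0) ENNReal.coe_ne_top,
          mul_one]

/-- For every number above the lower density of a relatively dense set there is a normalized hull
measure whose mass is bounded below in terms of it. -/
lemma exists_one_le_mul_hullMeasure (hG : IsAmenable G) (hΛ : IsRelativelySeparated Λ)
    (hdense : IsRelativelyDense Λ) {d : ℝ≥0∞} (hd : lowerBeurlingDensity m Λ < d) :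
    ∃ μ, IsNormalizedHullMeasure m Λ μ ∧ 1 ≤ d * μ univ := by
  let C : ClosedSubsets G := ⟨Λ, hΛ.isClosed⟩
  obtain ⟨R, hR, hRΛ⟩ := hdense
  -- As `φ = 1` on `R`, every translate of `Λ` has sum at least 1. In the limit this yields both `c
  -- ≠ 0` and the absence of mass at the empty set.
  obtain ⟨w, hw1, hws, -, hw01⟩ := exists_continuousMap_one_of_isCompact_subset_isOpen hR
    isOpen_univ (subset_univ R)
  let φ : C_c(G, ℝ≥0) := ⟨⟨fun x => (w x).toNNReal, by fun_prop⟩,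
    HasCompactSupport.comp_left (f := w) hws Real.toNNReal_zero⟩
  have hφt : ∫⁻ x, (φ x : ℝ≥0∞) ∂m ≠ ∞ := by
    change ∫⁻ x, ENNReal.ofReal (w x) ∂m ≠ ∞
    exact (w.continuous.integrable_of_hasCompactSupport hws).lintegral_lt_top.ne
  set Q : Set G := tsupport w with hQdef
  have hφ0 : ∀ x, x ∉ Q → φ x = 0 := fun x hx => by
    change (w x).toNNReal = 0
    rw [image_eq_zero_of_notMem_tsupport hx, Real.toNNReal_zero]
  have hφR : ∀ x ∈ R, φ x = 1 := fun x hx => by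
    change (w x).toNNReal = 1
    rw [hw1 hx, Pi.one_apply, Real.toNNReal_one]
  -- The count is taken on `K₀ n * S`, which after translation catches every point contributing to
  -- the average over `K n`; including 1 gives `K₀ n ⊆ K₀ n * S`.
  let S : Set G := {1} ∪ Q
  have hS : IsCompact S := isCompact_singleton.union hws
  obtain ⟨E⟩ : Nonempty (CompactExhaustion G) := inferInstance
  obtain ⟨K₀, hK₀⟩ := exists_folner_sequence (m := m) hG hS E
  have hKS : ∀ n, K₀ n ⊆ K₀ n * S := fun n => subset_mul_left _ (Or.inl rfl)
  have hy : ∀ n, ∃ y : G, ((Λ ∩ y • (K₀ n * S)).encard : ℝ≥0∞) ≤ d * m (K₀ n * S) := by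
    intro n
    have h1 := (le_iSup₂ (f := fun (K : Set G) (_ : IsCompact K ∧ 0 < m K) =>
      ⨅ x : G, ((Λ ∩ x • K).encard : ℝ≥0∞) / m K) (K₀ n * S) ⟨(hK₀ n).1.mul hS,
        (hK₀ n).2.1.trans_le (measure_mono (hKS n))⟩).trans_lt hd
    obtain ⟨y, hy⟩ := iInf_lt_iff.1 h1
    refine ⟨y, ?_⟩
    have h2 : m (K₀ n * S) ≠ 0 := ((hK₀ n).2.1.trans_le (measure_mono (hKS n))).ne'
    exact (ENNReal.div_le_iff h2 ((hK₀ n).1.mul hS).measure_lt_top.ne).1 hy.le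
  choose y hy using hy
  let K : ℕ → Set G := fun n => y n • K₀ n
  have hK : ∀ n, IsCompact (K n) := fun n => (hK₀ n).1.smul _
  have hmK : ∀ n, m (K n) = m (K₀ n) := fun n => measure_smul _ _ _
  have hK0 : ∀ n, 0 < m (K n) := fun n => hmK n ▸ (hK₀ n).2.1
  obtain ⟨ν, hν, hνinv, hνhull, s, hs, -, hlsc⟩ := exists_invariant_limit (C := C) rfl hK hK0
    (tendsto_measure_sdiff_div (E := E) hK fun n q hq => by
      rw [hmK]
      refine le_trans (measure_mono ?_) ((measure_smul m (y n) _).trans_le (hK₀ n).2.2)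
      refine union_subset (smul_set_mono (subset_mul_left _ ⟨1, Or.inl rfl, 1, Or.inl rfl,
        mul_one 1⟩)) ?_
      rintro _ ⟨_, ⟨k, hk, rfl⟩, q', hq', rfl⟩
      rw [mem_singleton_iff.1 hq']
      exact ⟨k * q, mul_mem_mul hk ⟨1, Or.inl rfl, q, Or.inr hq, one_mul q⟩, by
        simp [mul_assoc]⟩)
  obtain ⟨c, hc⟩ := exists_intensity m hΛ ν hνhull
  have hpos : ∀ᵐ P ∂ν, 1 ≤ ((rel Λ : ℕ∞) : ℝ≥0∞) * ∑' p : P.carrier, (φ p : ℝ≥0∞) := by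
    filter_upwards [hνhull] with P hP
    refine le_rel_mul_tsum_of_mem_hull hΛ φ.continuous φ.hasCompactSupport (fun x => ?_) hP
    obtain ⟨p, hpΛ, hpR⟩ := hRΛ x⁻¹
    have h1 : x * p ∈ R := by simpa using mem_smul_set_iff_inv_smul_mem.1 hpR
    have h2 := ENNReal.le_tsum (f := fun p : (x • Λ : Set G) => (φ p : ℝ≥0∞))
      ⟨x * p, p, hpΛ, rfl⟩
    rw [hφR _ h1, ENNReal.coe_one] at h2
    exact h2
  have hrelc : 1 ≤ ((rel Λ : ℕ∞) : ℝ≥0∞) * (c * ∫⁻ x, (φ x : ℝ≥0∞) ∂m) := by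
    rw [← hc φ, ← lintegral_const_mul _ (measurable_tsum φ)]
    calc (1 : ℝ≥0∞) = ∫⁻ _, 1 ∂ν := by simp
      _ ≤ _ := lintegral_mono_ae hpos
  have hc0 : c ≠ 0 := by
    rintro rfl
    simp at hrelc
  have hφpos : ∫⁻ x, (φ x : ℝ≥0∞) ∂m ≠ 0 := by
    intro h
    simp [h] at hrelc
  have hup : ∀ n : ℕ, ∫⁻ P, ∑' p : P.carrier, (φ p : ℝ≥0∞) ∂(orbitAverage m C (K n)) ≤
      ENNReal.ofReal (1 + 1 / ((n : ℝ) + 1)) * (d * ∫⁻ x, (φ x : ℝ≥0∞) ∂m) := by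
    intro n
    rw [lintegral_tsum_orbitAverage (C := C) rfl hΛ.countable, mul_comm, ← div_eq_mul_inv]
    refine ENNReal.div_le_of_le_mul ?_
    calc ∑' p : Λ, ∫⁻ x in K n, (φ (x⁻¹ * p) : ℝ≥0∞) ∂m
        ≤ ((Λ ∩ y n • (K₀ n * S)).encard : ℝ≥0∞) * ∫⁻ x, (φ x : ℝ≥0∞) ∂m := by
          refine tsum_le_encard_mul (φ := fun p => ∫⁻ x in K n, (φ (x⁻¹ * p) : ℝ≥0∞) ∂m)
            (fun p hp => ?_) fun p _ => ?_
          · rw [← lintegral_indicator (hK n).measurableSet]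
            refine lintegral_eq_zero_of_ae_eq_zero (ae_of_all _ fun x => ?_)
            by_cases hx : x ∈ K n
            · rw [indicator_of_mem hx, hφ0, ENNReal.coe_zero]
              · rfl
              · intro hxp
                obtain ⟨k, hk, rfl⟩ := hx
                exact hp ⟨k * ((y n • k)⁻¹ * p), mul_mem_mul hk (Or.inr hxp), by simp [mul_assoc]⟩
            · rw [indicator_of_notMem hx]
              rfl
          · rw [← lintegral_inv_mul_eq φ p]
            exact setLIntegral_le_lintegral _ _
      _ ≤ d * (ENNReal.ofReal (1 + 1 / ((n : ℝ) + 1)) * m (K₀ n)) *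
          ∫⁻ x, (φ x : ℝ≥0∞) ∂m := by
          gcongr
          refine (hy n).trans ?_
          gcongr
          refine (measure_mono (mul_subset_mul_left ?_)).trans (hK₀ n).2.2
          exact subset_mul_left _ (Or.inl rfl)
      _ = _ := by rw [hmK]; ring
  -- An upper bound is wanted here, so lower semicontinuity of the sum itself suffices and no factor
  -- `rel Λ` is lost.
  have hcd : (c : ℝ≥0∞) ≤ d := by
    obtain ⟨B, hB, hle⟩ := hΛ.exists_tsum_le φ
    have h1 := hlsc (fun P => ∑' p : P.carrier, (φ p : ℝ≥0∞))
      (lowerSemicontinuous_tsum (φ := fun p => (φ p : ℝ≥0∞))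
        (ENNReal.continuous_coe.comp φ.continuous)) B hB hle
    have h2 : Filter.Tendsto (fun n => ENNReal.ofReal (1 + 1 / ((s n : ℝ) + 1)) *
        (d * ∫⁻ x, (φ x : ℝ≥0∞) ∂m)) Filter.atTop (𝓝 (1 * (d * ∫⁻ x, (φ x : ℝ≥0∞) ∂m))) :=
      ENNReal.Tendsto.mul_const (tendsto_ofReal_one_add.comp hs.tendsto_atTop)
        (Or.inl one_ne_zero)
    have h3 := h1.trans (Filter.liminf_le_liminf (Filter.Eventually.of_forall
      fun n => hup (s n)))
    rw [h2.liminf_eq, one_mul, hc φ] at h3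
    exact (ENNReal.mul_le_mul_iff_left hφpos hφt).1 h3
  have hν1 : ν {P | P.carrier = ∅}ᶜ = 1 := by
    rw [prob_compl_eq_one_iff isClosed_setOf_carrier_eq_empty.measurableSet]
    refine measure_mono_null (fun P hP => ?_) (ae_iff.1 hpos)
    intro hle
    rw [show P.carrier = ∅ from hP, tsum_empty, mul_zero] at hle
    exact absurd hle (by simp)
  refine ⟨_, isNormalizedHullMeasure_smul_restrict m hνhull hc0 hc, ?_⟩
  rw [Measure.smul_apply, ENNReal.smul_def, smul_eq_mul, ENNReal.coe_inv hc0,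
    Measure.restrict_apply_univ, hν1, mul_one]
  rw [← ENNReal.mul_inv_cancel (a := (c : ℝ≥0∞)) (by simpa using hc0) ENNReal.coe_ne_top]
  gcongr

end Existence

/-! ### Comparison of densities and covolumes -/

section Comparison

variable {G : Type*} [Group G] [TopologicalSpace G] [IsTopologicalGroup G] [T2Space G]
  [LocallyCompactSpace G] [SecondCountableTopology G] [MeasurableSpace G] [BorelSpace G]
  {m : Measure G} [m.IsHaarMeasure] [m.IsMulRightInvariant] {Λ : Set G}

lemma upperBeurlingDensity_empty : upperBeurlingDensity m (∅ : Set G) = 0 := by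
  obtain ⟨K⟩ : Nonempty (TopologicalSpace.PositiveCompacts G) := inferInstance
  refine le_antisymm ((iInf₂_le (K : Set G)
    ⟨K.isCompact, Measure.measure_pos_of_nonempty_interior m K.interior_nonempty⟩).trans ?_)
    bot_le
  simp

lemma IsRelativelyDense.nonempty (h : IsRelativelyDense Λ) : Λ.Nonempty := by
  obtain ⟨K, -, hK⟩ := h
  exact (hK 1).mono inter_subset_left

lemma one_div_lowerCovolume_le (hΛ : IsRelativelySeparated Λ) :
    1 / lowerCovolume m Λ ≤ upperBeurlingDensity m Λ := by
  simp only [one_div, lowerCovolume, ENNReal.inv_iInf]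
  refine iSup₂_le fun μ hμ => ?_
  rw [measure_puncturedHull hμ]
  exact inv_measure_le_upperBeurlingDensity hΛ hμ

lemma inv_rel_mul_upperBeurlingDensity_le (hG : IsAmenable G) (hΛ : IsRelativelySeparated Λ) :
    ((rel Λ : ℕ∞) : ℝ≥0∞)⁻¹ * upperBeurlingDensity m Λ ≤ 1 / lowerCovolume m Λ := by
  -- For `Λ = ∅` the inverse of `rel Λ` may be infinite, but the density is zero and `∞ * 0 = 0`.
  rcases Λ.eq_empty_or_nonempty with rfl | hne
  · rw [upperBeurlingDensity_empty, mul_zero]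
    exact bot_le
  have hr1 : (1 : ℝ≥0∞) ≤ ((rel Λ : ℕ∞) : ℝ≥0∞) := by exact_mod_cast one_le_rel hne
  have hr0 : ((rel Λ : ℕ∞) : ℝ≥0∞) ≠ 0 := (one_pos.trans_le hr1).ne'
  have hrt : ((rel Λ : ℕ∞) : ℝ≥0∞) ≠ ∞ := by simpa using hΛ.ne
  rw [mul_comm, ← div_eq_mul_inv]
  refine ENNReal.div_le_of_le_mul (le_of_forall_lt_imp_le_of_dense fun d hd => ?_)
  rcases eq_or_ne d 0 with rfl | hd0
  · exact bot_le
  obtain ⟨μ, hμ, hle⟩ := exists_hullMeasure_mul_le_rel hG hΛ hd0 hd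
  have hcov : lowerCovolume m Λ ≤ μ univ :=
    (iInf₂_le μ hμ).trans_eq (measure_puncturedHull hμ)
  calc d ≤ ((rel Λ : ℕ∞) : ℝ≥0∞) / lowerCovolume m Λ :=
        (ENNReal.le_div_iff_mul_le (Or.inr hr0) (Or.inr hrt)).2 (le_trans (by gcongr) hle)
    _ = _ := by rw [div_eq_mul_inv, one_div, mul_comm]

lemma inv_rel_mul_lowerBeurlingDensity_le (hΛ : IsRelativelySeparated Λ)
    (hdense : IsRelativelyDense Λ) :
    ((rel Λ : ℕ∞) : ℝ≥0∞)⁻¹ * lowerBeurlingDensity m Λ ≤ 1 / upperCovolume m Λ := by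
  have hr1 : (1 : ℝ≥0∞) ≤ ((rel Λ : ℕ∞) : ℝ≥0∞) := by exact_mod_cast one_le_rel hdense.nonempty
  have hr0 : ((rel Λ : ℕ∞) : ℝ≥0∞) ≠ 0 := (one_pos.trans_le hr1).ne'
  have hrt : ((rel Λ : ℕ∞) : ℝ≥0∞) ≠ ∞ := by simpa using hΛ.ne
  simp only [one_div, upperCovolume, ENNReal.inv_iSup]
  refine le_iInf₂ fun μ hμ => ?_
  rw [measure_puncturedHull hμ, mul_comm, ← div_eq_mul_inv]
  refine ENNReal.div_le_of_le_mul ?_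
  rw [mul_comm, ← div_eq_mul_inv]
  exact (ENNReal.le_div_iff_mul_le (Or.inr hr0) (Or.inr hrt)).2
    (lowerBeurlingDensity_mul_measure_le hΛ hμ)

lemma one_div_upperCovolume_le (hG : IsAmenable G) (hΛ : IsRelativelySeparated Λ)
    (hdense : IsRelativelyDense Λ) : 1 / upperCovolume m Λ ≤ lowerBeurlingDensity m Λ := by
  refine le_of_forall_gt_imp_ge_of_dense fun d hd => ?_
  obtain ⟨μ, hμ, hle⟩ := exists_one_le_mul_hullMeasure hG hΛ hdense hd
  have hcov : μ univ ≤ upperCovolume m Λ :=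
    (measure_puncturedHull hμ).symm.trans_le
      (le_iSup₂ (f := fun (μ : Measure (ClosedSubsets G)) (_ : IsNormalizedHullMeasure m Λ μ) =>
        μ (puncturedHull Λ)) μ hμ)
  exact ENNReal.div_le_of_le_mul (hle.trans (by gcongr))

lemma IsDelone.rel_eq_one (h : IsDelone Λ) : rel Λ = 1 :=
  le_antisymm h.1.rel_le_one (one_le_rel h.2.nonempty)

end Comparison

end PointSetCovolume

/-! ### The main theorem. -/

theorem theorem1p1 {G : Type*} [Group G] [TopologicalSpace G] [IsTopologicalGroup G]
    [T2Space G] [LocallyCompactSpace G] [SecondCountableTopology G]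
    [MeasurableSpace G] [BorelSpace G]
    (hG : PointSetCovolume.IsAmenable G)
    (m : Measure G) [m.IsHaarMeasure] [m.IsMulRightInvariant]
    (Λ : Set G) :
    (IsDelone Λ →
      lowerBeurlingDensity m Λ = 1 / upperCovolume m Λ ∧
      upperBeurlingDensity m Λ = 1 / lowerCovolume m Λ) ∧
    (IsRelativelySeparated Λ →
      ((rel Λ : ℕ∞) : ℝ≥0∞)⁻¹ * upperBeurlingDensity m Λ ≤ 1 / lowerCovolume m Λ ∧
      1 / lowerCovolume m Λ ≤ upperBeurlingDensity m Λ) ∧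
    (IsRelativelySeparated Λ → IsRelativelyDense Λ →
      ((rel Λ : ℕ∞) : ℝ≥0∞)⁻¹ * lowerBeurlingDensity m Λ ≤ 1 / upperCovolume m Λ ∧
      1 / upperCovolume m Λ ≤ lowerBeurlingDensity m Λ) := by
  refine ⟨fun h => ?_, fun hΛ => ⟨inv_rel_mul_upperBeurlingDensity_le hG hΛ,
    one_div_lowerCovolume_le hΛ⟩, fun hΛ hdense => ⟨inv_rel_mul_lowerBeurlingDensity_le hΛ hdense,
    one_div_upperCovolume_le hG hΛ hdense⟩⟩
  have hrel := h.rel_eq_one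
  have hΛ : IsRelativelySeparated Λ := by
    rw [IsRelativelySeparated, hrel]
    exact ENat.one_lt_top
  have hlower := inv_rel_mul_lowerBeurlingDensity_le (m := m) hΛ h.2
  have hupper := inv_rel_mul_upperBeurlingDensity_le (m := m) hG hΛ
  rw [hrel, ENat.toENNReal_one, inv_one, one_mul] at hlower hupper
  exact ⟨hlower.antisymm (one_div_upperCovolume_le hG hΛ h.2),
    hupper.antisymm (one_div_lowerCovolume_le hΛ)⟩
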